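/- Consider the degraded discrete-time Poisson wiretap channel with slot duration $\Delta>0$, channel gains $\alpha_B,\alpha_E>0$ and dark currents $\lambda_B,\lambda_E>0$: given an input intensity $X=x\ge 0$, the legitimate receiver's output $Y$ is Poisson distributed with mean $(\alpha_B x+\lambda_B)\Delta$ and the eavesdropper's output $Z$ is Poisson distributed with mean $(\alpha_E x+\lambda_E)\Delta$. Assume $\alpha_B\ge\alpha_E$ and $\lambda_B/\alpha_B\le\lambda_E/\alpha_E$, with at least one of the two inequalities strict. For $\mathcal A>0$ and $\mathcal E>0$ let $\Omega^+_{\mathcal A,\mathcal E}$ be the set of all probability distributions $F$ on $[0,\mathcal A]$ with $\int x\,dF(x)\le\mathcal E$. For an input $X\sim F$ let $I_B(F)=\frac1\Delta I(X;Y)$ and $I_E(F)=\frac1\Delta I(X;Z)$ be the mutual informations per unit of time. A pair $(R,R_e)$ is said to be achieved by $F$ if $0\le R\le I_B(F)$ and $0\le R_e\le I_B(F)-I_E(F)$; the rate-equivocation region $\mathcal R\subset\mathbb R^2$ is the set of all pairs achieved by some $F\in\Omega^+_{\mathcal A,\mathcal E}$. Its (outer) boundary consists of those points $(R,R_e)$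 of the topological boundary of $\mathcal R$ for which no $(R',R_e')\in\mathcal R$ satisfies both $R'>R$ and $R_e'>R_e$. Then $I_B(F)$ and $I_E(F)$ are finite for every $F\in\Omega^+_{\mathcal A,\mathcal E}$, and: (1) For every $\mu\in[0,1]$ the functional $f_\mu(F)=\mu I_B(F)+(1-\mu)\,[I_B(F)-I_E(F)]$ has a unique maximizer $F^*$ over $\Omega^+_{\mathcal A,\mathcal E}$. This maximizer is discrete with finitely many mass points, and the point $(I_B(F^*),\,I_B(F^*)-I_E(F^*))$ lies on the outer boundary of $\mathcal R$. (2) Every point of the outer boundary of $\mathcal R$ is achieved by exactly one $F\in\Omega^+_{\mathcal A,\mathcal E}$. This $F$ is discrete with finitely many mass points, and it maximizes $f_\mu$ over $\Omega^+_{\mathcal A,\mathcal E}$ for some $\mu\in[0,1]$. -/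

import Mathlib

open MeasureTheory ProbabilityTheory Set
open scoped ENNReal NNReal

noncomputable section

/-- The parameters of a discrete-time Poisson wiretap channel: the channel gains and the dark
currents of the legitimate receiver (`B`) and of the eavesdropper (`E`), and the slot length. -/
structure PoissonWiretap where
  gainB : ℝ
  gainE : ℝ
  darkB : ℝ
  darkE : ℝ
  slot : ℝ

/-- The standing assumptions: all parameters are positive (positivity of `gainB` follows from
`gain_le`), the channel is degraded, and the two receivers' channels do not coincide, i.e. at least
one of the two degradedness inequalities is strict. -/
structure PoissonWiretap.IsDegraded (W : PoissonWiretap) : Prop where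
  slot_pos : 0 < W.slot
  gainE_pos : 0 < W.gainE
  darkB_pos : 0 < W.darkB
  darkE_pos : 0 < W.darkE
  gain_le : W.gainE ≤ W.gainB
  dark_le : W.darkB / W.gainB ≤ W.darkE / W.gainE
  strict : W.gainE < W.gainB ∨ W.darkB / W.gainB < W.darkE / W.gainE

theorem measurable_poissonMeasure : Measurable (fun r : ℝ≥0 => poissonMeasure r) := by
  refine Measure.measurable_of_measurable_coe _ fun s hs => ?_
  simp only [poissonMeasure, Measure.sum_apply _ hs, Measure.smul_apply, smul_eq_mul]
  refine Measurable.ennreal_tsum fun n => ?_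
  exact Measurable.mul_const (by fun_prop) _

/-- The Poisson channel: given the input intensity `x`, the output is Poisson distributed with mean
`(gain * x + dark) * slot`. (The truncation `toNNReal` is inactive for `x ≥ 0`.) -/
def poissonChannel (gain dark slot : ℝ) : Kernel ℝ ℕ where
  toFun x := poissonMeasure ((gain * x + dark) * slot).toNNReal
  measurable' := measurable_poissonMeasure.comp (by fun_prop)

/-- Mutual information (in nats) between the input and the output of the channel `κ` when the input
has law `F`: the Kullback-Leibler divergence of the joint law from the product of its marginals. -/
def mutualInfo {α β : Type*} [MeasurableSpace α] [MeasurableSpace β]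
    (F : Measure α) (κ : Kernel α β) : ℝ≥0∞ :=
  InformationTheory.klDiv (F.compProd κ) (F.prod (F.bind κ))

/-- The inputs with peak-intensity constraint `A` and average-intensity constraint `E`: the laws
carried by `[0, A]` with mean at most `E`. -/
def feasibleInputs (A E : ℝ) : Set (ProbabilityMeasure ℝ) :=
  {F | (F : Measure ℝ) (Icc 0 A) = 1 ∧ ∫ x in Icc 0 A, x ∂(F : Measure ℝ) ≤ E}

/-- A law is discrete with finitely many mass points if some finite set carries all its mass. -/
def IsFinitelyDiscrete (F : ProbabilityMeasure ℝ) : Prop :=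
  ∃ S : Finset ℝ, (F : Measure ℝ) ((S : Set ℝ)ᶜ) = 0

namespace PoissonWiretap

variable (W : PoissonWiretap)

/-- The channel from the transmitter to the legitimate receiver. -/
def channelB : Kernel ℝ ℕ := poissonChannel W.gainB W.darkB W.slot

/-- The channel from the transmitter to the eavesdropper. -/
def channelE : Kernel ℝ ℕ := poissonChannel W.gainE W.darkE W.slot

/-- `I(X;Y)` per unit of time, for an input of law `F`. -/
def infoB (F : ProbabilityMeasure ℝ) : ℝ :=
  1 / W.slot * (mutualInfo (F : Measure ℝ) W.channelB).toReal

/-- `I(X;Z)` per unit of time, for an input of law `F`. -/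
def infoE (F : ProbabilityMeasure ℝ) : ℝ :=
  1 / W.slot * (mutualInfo (F : Measure ℝ) W.channelE).toReal

/-- The objective `μ I(X;Y) + (1 - μ) [I(X;Y) - I(X;Z)]`. -/
def objective (μ : ℝ) (F : ProbabilityMeasure ℝ) : ℝ :=
  μ * W.infoB F + (1 - μ) * (W.infoB F - W.infoE F)

/-- The input law `F` achieves the rate-equivocation pair `p = (R, Rₑ)`. -/
def Achieves (F : ProbabilityMeasure ℝ) (p : ℝ × ℝ) : Prop :=
  (0 ≤ p.1 ∧ p.1 ≤ W.infoB F) ∧ (0 ≤ p.2 ∧ p.2 ≤ W.infoB F - W.infoE F)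

/-- The rate-equivocation region under peak- and average-intensity constraints. -/
def region (A E : ℝ) : Set (ℝ × ℝ) :=
  {p | ∃ F ∈ feasibleInputs A E, W.Achieves F p}

/-- The boundary of the rate-equivocation region: the topological boundary points at which rate and
equivocation cannot both be increased. (For this region it leaves out exactly the boundary points
that lie on a coordinate axis for the sole reason that rates and equivocations are nonnegative.) -/
def boundary (A E : ℝ) : Set (ℝ × ℝ) :=
  {p | p ∈ frontier (W.region A E) ∧ ∀ q ∈ W.region A E, ¬ (p.1 < q.1 ∧ p.2 < q.2)}

end PoissonWiretap

end

/-!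
The eavesdropper's output is a binomial thinning of the legitimate receiver's output plus
independent Poisson noise. Write `ν = 1 - μ`, so that the objective is `I(X;Y) - ν I(X;Z)` up to the
factor `1/Δ`. For input laws `F` and `G` with output laws `F_Y`, `G_Y`, `F_Z`, `G_Z`, averaging
under `G` the information densities belonging to `F`, instead of those belonging to `G`, increases
this difference by `D(G_Y ‖ F_Y) - ν D(G_Z ‖ F_Z)`. This is positive for `F ≠ G` and `ν ≤ 1`,
because data processing through the thinning is strict (any two counts can yield a common output)
and the output law determines the input law. Hence the objective is strictly concave, and since the
feasible laws form a compact set on which it is continuous, it has exactly one maximizer.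

By first-order optimality and a Lagrange multiplier for the mean constraint, the difference of
information densities at the maximizer agrees with an affine function of the intensity almost
everywhere under it. As a function of the mean of `Y` this difference is analytic on `(0, ∞)`, and
it cannot be affine there since a term `t log t` with positive coefficient survives at `t = 0`.
Hence it meets the affine function only finitely often on the compact range of means, and the
maximizer is finitely supported.

Compactness makes the rate-equivocation region closed and concavity makes it convex, so each
boundary point has a supporting line; the normalized normal vector is `(μ, 1 - μ)`, and every law
that achieves the point maximizes the objective of weight `μ`.
-/

open InformationTheory Filter
open scoped Topology

section Divergence

variable {α β γ : Type*} [MeasurableSpace α] [MeasurableSpace β] [MeasurableSpace γ]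

theorem klDiv_map_measurableEquiv (e : α ≃ᵐ β) (μ ν : Measure α) [IsFiniteMeasure μ]
    [IsFiniteMeasure ν] : klDiv (μ.map e) (ν.map e) = klDiv μ ν := by
  refine (klDiv_map_le μ ν e.measurable).antisymm ?_
  simpa only [MeasurableEquiv.map_map_symm, MeasurableEquiv.map_symm_map] using
    klDiv_map_le (μ.map e) (ν.map e) e.symm.measurable

theorem klDiv_map_swap (μ ν : Measure (α × β)) [IsFiniteMeasure μ] [IsFiniteMeasure ν] :
    klDiv (μ.map Prod.swap) (ν.map Prod.swap) = klDiv μ ν :=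
  klDiv_map_measurableEquiv MeasurableEquiv.prodComm μ ν

theorem klDiv_eq_klDiv_comp_add_klDiv_posterior [StandardBorelSpace α] [Nonempty α]
    (P Q : Measure α) [IsFiniteMeasure P] [IsFiniteMeasure Q]
    (κ : Kernel α β) [IsMarkovKernel κ] :
    klDiv P Q = klDiv (κ ∘ₘ P) (κ ∘ₘ Q) +
      klDiv ((κ ∘ₘ P) ⊗ₘ posterior κ P) ((κ ∘ₘ P) ⊗ₘ posterior κ Q) := by
  rw [← klDiv_compProd_eq_add, compProd_posterior_eq_map_swap, compProd_posterior_eq_map_swap,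
    klDiv_map_swap, klDiv_compProd_left]

theorem compProd_singleton [MeasurableSingletonClass α] [MeasurableSingletonClass β]
    (P : Measure α) [SFinite P] (κ : Kernel α β) [IsSFiniteKernel κ] (a : α) (b : β) :
    (P ⊗ₘ κ) {(a, b)} = P {a} * κ a {b} := by
  rw [← singleton_prod_singleton,
    Measure.compProd_apply_prod (.singleton a) (.singleton b), lintegral_singleton, mul_comm]

theorem comp_mul_posterior_singleton [StandardBorelSpace α] [Nonempty α]
    [MeasurableSingletonClass β]
    (P : Measure α) [IsFiniteMeasure P] (κ : Kernel α β) [IsMarkovKernel κ] (a : α) (b : β) :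
    (κ ∘ₘ P) {b} * posterior κ P b {a} = P {a} * κ a {b} := by
  rw [← compProd_singleton, ← compProd_singleton, compProd_posterior_eq_map_swap,
    Measure.map_apply measurable_swap (.singleton _)]
  congr 1
  ext ⟨a', b'⟩
  simp [and_comm]

theorem comp_singleton_mul_eq_of_klDiv_comp_eq [StandardBorelSpace α] [Nonempty α]
    [MeasurableSingletonClass β] {P Q : Measure α} [IsFiniteMeasure P] [IsFiniteMeasure Q]
    {κ : Kernel α β} [IsMarkovKernel κ] (htop : klDiv P Q ≠ ∞)
    (heq : klDiv (κ ∘ₘ P) (κ ∘ₘ Q) = klDiv P Q) {a : α} {b : β} (hab : κ a {b} ≠ 0) :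
    (κ ∘ₘ Q) {b} * P {a} = (κ ∘ₘ P) {b} * Q {a} := by
  have hpost : (κ ∘ₘ P) ⊗ₘ posterior κ P = (κ ∘ₘ P) ⊗ₘ posterior κ Q := by
    rw [← klDiv_eq_zero_iff]
    have hsplit := klDiv_eq_klDiv_comp_add_klDiv_posterior P Q κ
    rw [heq] at hsplit
    exact (ENNReal.add_right_inj htop).mp (by rw [← hsplit, add_zero])
  have hpost_ab : (κ ∘ₘ P) {b} * posterior κ P b {a} = (κ ∘ₘ P) {b} * posterior κ Q b {a} := by
    rw [← compProd_singleton, hpost, compProd_singleton]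
  rw [← ENNReal.mul_left_inj hab (measure_ne_top _ _)]
  calc (κ ∘ₘ Q) {b} * P {a} * κ a {b}
      = (κ ∘ₘ Q) {b} * ((κ ∘ₘ P) {b} * posterior κ Q b {a}) := by
        rw [← hpost_ab, comp_mul_posterior_singleton, mul_assoc]
    _ = (κ ∘ₘ P) {b} * ((κ ∘ₘ Q) {b} * posterior κ Q b {a}) := mul_left_comm _ _ _
    _ = (κ ∘ₘ P) {b} * Q {a} * κ a {b} := by
        rw [comp_mul_posterior_singleton, mul_assoc]

theorem eq_of_klDiv_comp_eq [Countable α] [DiscreteMeasurableSpace α]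
    [MeasurableSingletonClass β] {P Q : Measure α} [IsProbabilityMeasure P] [IsProbabilityMeasure Q]
    {κ : Kernel α β} [IsMarkovKernel κ] (hκ : ∀ a a', ∃ b, κ a {b} ≠ 0 ∧ κ a' {b} ≠ 0)
    (htop : klDiv P Q ≠ ∞) (heq : klDiv (κ ∘ₘ P) (κ ∘ₘ Q) = klDiv P Q) : P = Q := by
  have : Nonempty α := P.nonempty_of_neZero
  obtain ⟨a₀, ha₀⟩ : ∃ a₀, P {a₀} ≠ 0 := by
    by_contra! hnull
    exact NeZero.ne P (Measure.ext_of_singleton fun a => by simp [hnull a])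
  have hcross : ∀ a, Q {a₀} * P {a} = P {a₀} * Q {a} := by
    intro a
    obtain ⟨b, hb₀, hb⟩ := hκ a₀ a
    have hPb : (κ ∘ₘ P) {b} ≠ 0 := by
      intro hzero
      rw [Measure.bind_apply (.singleton b) κ.measurable.aemeasurable,
        lintegral_eq_zero_iff (κ.measurable_coe (.singleton b))] at hzero
      exact hb₀ (ae_iff_of_countable.mp hzero a₀ ha₀)
    rw [← ENNReal.mul_right_inj hPb (measure_ne_top _ _)]
    calc (κ ∘ₘ P) {b} * (Q {a₀} * P {a})
        = (κ ∘ₘ Q) {b} * P {a₀} * P {a} := by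
          rw [comp_singleton_mul_eq_of_klDiv_comp_eq htop heq hb₀, mul_assoc]
      _ = P {a₀} * ((κ ∘ₘ Q) {b} * P {a}) := by ring
      _ = (κ ∘ₘ P) {b} * (P {a₀} * Q {a}) := by
          rw [comp_singleton_mul_eq_of_klDiv_comp_eq htop heq hb, mul_left_comm]
  have hmass : ∀ R : Measure α, IsProbabilityMeasure R → ∑' a, R {a} = 1 := fun R _ => by
    simpa using (lintegral_countable' (μ := R) 1).symm
  have hatom : Q {a₀} = P {a₀} := by
    calc Q {a₀} = ∑' a, Q {a₀} * P {a} := by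
          rw [ENNReal.tsum_mul_left, hmass P inferInstance, mul_one]
      _ = ∑' a, P {a₀} * Q {a} := by simp only [hcross]
      _ = P {a₀} := by rw [ENNReal.tsum_mul_left, hmass Q inferInstance, mul_one]
  refine Measure.ext_of_singleton fun a => ?_
  have h := hcross a
  rwa [hatom, ENNReal.mul_right_inj ha₀ (measure_ne_top _ _)] at h

/-- The divergence `D(G ⊗ κ ‖ G × κF)` of the true joint law of input and output from the product
law in which the output law is computed from the input law `F` instead of `G`. It is affine in `G`,
and it is the mutual information `I(G, κ)` when `F = G`. -/
noncomputable def crossInfo (κ : Kernel α β) (F G : Measure α) : ℝ≥0∞ :=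
  klDiv (G ⊗ₘ κ) (G.prod (F.bind κ))

theorem crossInfo_eq_klDiv_add_mutualInfo [StandardBorelSpace α] [Nonempty α]
    (κ : Kernel α β) [IsMarkovKernel κ] (F G : Measure α) [IsFiniteMeasure F]
    [IsProbabilityMeasure G] :
    crossInfo κ F G = klDiv (κ ∘ₘ G) (κ ∘ₘ F) + mutualInfo G κ := by
  have hswap : ∀ H : Measure α, IsFiniteMeasure H → crossInfo κ H G =
      klDiv ((κ ∘ₘ G) ⊗ₘ posterior κ G) ((κ ∘ₘ H) ⊗ₘ Kernel.const β G) := fun H _ => by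
    rw [crossInfo, ← klDiv_map_swap, ← compProd_posterior_eq_map_swap, Measure.prod_swap,
      Measure.compProd_const]
  rw [hswap F inferInstance, klDiv_compProd_eq_add]
  exact congrArg (_ + ·) (hswap G inferInstance).symm

theorem mutualInfo_comp_le (η : Kernel β γ) [IsMarkovKernel η]
    (κ : Kernel α β) [IsMarkovKernel κ] (F : Measure α) [IsFiniteMeasure F] :
    mutualInfo F (η ∘ₖ κ) ≤ mutualInfo F κ := by
  rw [mutualInfo, ← Measure.parallelComp_comp_compProd, ← Measure.comp_assoc,
    Measure.prod_comp_right]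
  exact klDiv_comp_right_le _ _ _

end Divergence

section Poisson

open unitInterval
open scoped Nat

theorem integral_cpow_poissonMeasure (r : ℝ≥0) (z : ℂ) :
    ∫ y, z ^ y ∂poissonMeasure r = Complex.exp ((z - 1) * r) := by
  have hexp := (NormedSpace.expSeries_div_hasSum_exp (z * (r : ℂ))).mul_left (Complex.exp (-r))
  rw [← Complex.exp_eq_exp_ℂ, ← Complex.exp_add] at hexp
  rw [integral_poissonMeasure, show (z - 1) * (r : ℂ) = -r + z * r by ring, ← hexp.tsum_eq]
  refine tsum_congr fun n => ?_
  rw [mul_pow, Complex.real_smul]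
  push_cast
  ring

theorem integral_pow_poissonMeasure (r : ℝ≥0) (b : ℝ) :
    ∫ y, b ^ y ∂poissonMeasure r = Real.exp ((b - 1) * r) := by
  have h := integral_cpow_poissonMeasure r b
  simp only [← Complex.ofReal_pow, integral_complex_ofReal] at h
  exact_mod_cast h

theorem integrable_pow_poissonMeasure (r : ℝ≥0) (b : ℝ) :
    Integrable (fun y => b ^ y) (poissonMeasure r) := by
  rw [integrable_poissonMeasure_iff]
  refine ((Real.summable_pow_div_factorial (|b| * r)).mul_left (Real.exp (-r))).congr fun n => ?_
  rw [norm_pow, Real.norm_eq_abs, mul_pow]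
  ring

theorem integrable_poissonMeasure_of_norm_le_pow {G : Type*} [NormedAddCommGroup G] {f : ℕ → G}
    {K b : ℝ} (hf : ∀ y, ‖f y‖ ≤ K * b ^ y) (r : ℝ≥0) : Integrable f (poissonMeasure r) :=
  ((integrable_pow_poissonMeasure r b).const_mul K).mono' .of_discrete (.of_forall hf)

theorem integral_norm_poissonMeasure_le {G : Type*} [NormedAddCommGroup G] {f : ℕ → G}
    {K b : ℝ} (hf : ∀ y, ‖f y‖ ≤ K * b ^ y) (r : ℝ≥0) :
    ∫ y, ‖f y‖ ∂poissonMeasure r ≤ K * Real.exp ((b - 1) * r) := by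
  rw [← integral_pow_poissonMeasure, ← integral_const_mul]
  exact integral_mono (integrable_poissonMeasure_of_norm_le_pow hf r).norm
    ((integrable_pow_poissonMeasure r b).const_mul K) hf

theorem integral_id_poissonMeasure (r : ℝ≥0) : ∫ y, (y : ℝ) ∂poissonMeasure r = r := by
  have hshift := (hasSum_one_poissonMeasure r).mul_left (r : ℝ)
  rw [mul_one] at hshift
  rw [integral_poissonMeasure]
  refine HasSum.tsum_eq ((hasSum_nat_add_iff' 1).1 ?_)
  simp only [Finset.range_one, Finset.sum_singleton, CharP.cast_eq_zero, smul_zero, sub_zero]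
  refine hshift.congr_fun fun n => ?_
  rw [Nat.factorial_succ, smul_eq_mul]
  push_cast
  field_simp
  ring

theorem integral_cpow_binomial (n : ℕ) (θ : I) (z : ℂ) :
    ∫ y, z ^ y ∂binomial n θ = (1 - θ + θ * z) ^ n := by
  have hrange : Finset.Iic n = Finset.range (n + 1) := by ext; simp
  rw [integral_binomial, hrange, add_comm (1 - (θ : ℂ)), add_pow]
  refine Finset.sum_congr rfl fun k _ => ?_
  rw [Complex.real_smul]
  push_cast
  ring

theorem integrable_cpow_of_norm_le_one (P : Measure ℕ) [IsFiniteMeasure P] {z : ℂ} (hz : ‖z‖ ≤ 1) :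
    Integrable (fun y => z ^ y) P :=
  .of_bound .of_discrete 1 (.of_forall fun y => by
    rw [norm_pow]; exact pow_le_one₀ (norm_nonneg z) hz)

theorem ext_of_integral_cpow_eq {P Q : Measure ℕ} [IsFiniteMeasure P] [IsFiniteMeasure Q]
    (h : ∀ z : ℂ, ‖z‖ = 1 → ∫ y, z ^ y ∂P = ∫ y, z ^ y ∂Q) : P = Q := by
  have hchar : ∀ (S : Measure ℕ) (t : ℝ), charFun (S.map (Nat.cast : ℕ → ℝ)) t =
      ∫ y, Complex.exp (t * Complex.I) ^ y ∂S := fun S t => by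
    rw [charFun_apply_real, integral_map .of_discrete (by fun_prop)]
    refine integral_congr_ae (.of_forall fun y => ?_)
    change Complex.exp (t * ((y : ℝ) : ℂ) * Complex.I) = _
    rw [← Complex.exp_nat_mul, Complex.ofReal_natCast]
    ring_nf
  apply (MeasurableEmbedding.natCast (α := ℝ)).map_injective
  refine Measure.ext_of_charFun (funext fun t => ?_)
  rw [hchar, hchar, h _ (Complex.norm_exp_ofReal_mul_I t)]

theorem integral_comp_kernel {α β G : Type*} [MeasurableSpace α] [MeasurableSpace β]
    [NormedAddCommGroup G] [NormedSpace ℝ G] {P : Measure α} {κ : Kernel α β} {f : β → G}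
    (hf : Integrable f (κ ∘ₘ P)) : ∫ y, f y ∂(κ ∘ₘ P) = ∫ x, ∫ y, f y ∂κ x ∂P := by
  rw [Measure.comp_eq_comp_const_apply] at hf ⊢
  rw [Kernel.integral_comp hf, Kernel.const_apply]

/-- Binomial thinning of a count with retention probability `θ`, followed by independent Poisson
noise of mean `c`. -/
noncomputable def thinningKernel (θ : I) (c : ℝ≥0) : Kernel ℕ ℕ :=
  Kernel.ofFunOfCountable fun n => Measure.conv (binomial n θ) (poissonMeasure c)

instance (θ : I) (c : ℝ≥0) : IsMarkovKernel (thinningKernel θ c) :=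
  ⟨fun n => inferInstanceAs (IsProbabilityMeasure (Measure.conv (binomial n θ) (poissonMeasure c)))⟩

theorem integral_cpow_thinningKernel (θ : I) (c : ℝ≥0) (n : ℕ) {z : ℂ} (hz : ‖z‖ ≤ 1) :
    ∫ y, z ^ y ∂thinningKernel θ c n = Complex.exp ((z - 1) * c) * (1 - θ + θ * z) ^ n := by
  change ∫ y, z ^ y ∂Measure.conv (binomial n θ) (poissonMeasure c) = _
  rw [integral_conv (integrable_cpow_of_norm_le_one _ hz)]
  simp only [pow_add, integral_const_mul, integral_mul_const, integral_cpow_poissonMeasure,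
    integral_cpow_binomial, mul_comm]

theorem thinningKernel_comp_poissonMeasure (θ : I) (b c : ℝ≥0) :
    thinningKernel θ c ∘ₘ poissonMeasure b = poissonMeasure (Real.toNNReal θ * b + c) := by
  refine ext_of_integral_cpow_eq fun z hz => ?_
  rw [integral_comp_kernel (integrable_cpow_of_norm_le_one _ hz.le)]
  simp only [integral_cpow_thinningKernel θ c _ hz.le, integral_const_mul,
    integral_cpow_poissonMeasure, ← Complex.exp_add]
  congr 1
  push_cast
  rw [Real.coe_toNNReal _ θ.2.1]
  ring

theorem binomial_mul_poissonMeasure_le_thinningKernel (θ : I) (c : ℝ≥0) (n k j : ℕ) :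
    binomial n θ {k} * poissonMeasure c {j} ≤ thinningKernel θ c n {k + j} := by
  change _ ≤ Measure.conv (binomial n θ) (poissonMeasure c) {k + j}
  rw [Measure.conv, Measure.map_apply (by fun_prop) (.singleton _), ← Measure.prod_prod]
  refine measure_mono ?_
  rintro ⟨_, _⟩ ⟨rfl, rfl⟩
  rfl

theorem thinningKernel_overlap {θ : I} {c : ℝ≥0} (hθ : 0 < (θ : ℝ)) (hlossy : (θ : ℝ) < 1 ∨ 0 < c)
    (n m : ℕ) : ∃ y, thinningKernel θ c n {y} ≠ 0 ∧ thinningKernel θ c m {y} ≠ 0 := by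
  rcases hlossy with hθ1 | hc
  · have hzero : ∀ k, thinningKernel θ c k {0} ≠ 0 := fun k => by
      refine (lt_of_lt_of_le ?_ (binomial_mul_poissonMeasure_le_thinningKernel θ c k 0 0)).ne'
      have : (0 : ℝ) < 1 - θ := sub_pos.2 hθ1
      rw [binomial_singleton, poissonMeasure_singleton, ← ENNReal.ofReal_mul (by positivity)]
      simpa using by positivity
    exact ⟨0, hzero n, hzero m⟩
  · have hlarge : ∀ k l, k ≤ l → thinningKernel θ c k {l} ≠ 0 := fun k l hkl => by
      obtain ⟨j, rfl⟩ := Nat.exists_eq_add_of_le hkl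
      refine (lt_of_lt_of_le ?_ (binomial_mul_poissonMeasure_le_thinningKernel θ c k k j)).ne'
      rw [binomial_singleton, poissonMeasure_singleton, ← ENNReal.ofReal_mul (by simp [hθ.le])]
      simpa using by positivity
    exact ⟨max n m, hlarge _ _ (le_max_left n m), hlarge _ _ (le_max_right n m)⟩

end Poisson

section PoissonRateKernel

open scoped Nat

variable {α : Type*} [MeasurableSpace α]

theorem measurable_kernel_singleton_div {β : Type*} [MeasurableSpace β] [Countable β]
    [DiscreteMeasurableSpace β] (κ : Kernel α β) (ν : Measure β) :
    Measurable fun p : α × β => κ p.1 {p.2} / ν {p.2} := by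
  refine measurable_from_prod_countable_left fun y => ?_
  exact (κ.measurable_coe (.singleton y)).div_const (ν {y})

theorem compProd_eq_withDensity_prod {β : Type*} [MeasurableSpace β] [Countable β]
    [DiscreteMeasurableSpace β] (G : Measure α) [SFinite G] (κ : Kernel α β)
    [IsSFiniteKernel κ] (ν : Measure β) [IsFiniteMeasure ν] (hν : ∀ y, ν {y} ≠ 0) :
    G ⊗ₘ κ = (G.prod ν).withDensity fun p => κ p.1 {p.2} / ν {p.2} := by
  have hmeas : Measurable (Function.uncurry fun x y => κ x {y} / ν {y}) :=
    measurable_kernel_singleton_div κ ν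
  have hκ : κ = Kernel.withDensity (Kernel.const α ν) fun x y => κ x {y} / ν {y} := by
    ext x : 1
    refine Measure.ext_of_singleton fun y => ?_
    rw [Kernel.withDensity_apply _ hmeas, Kernel.const_apply, withDensity_apply _ (.singleton y),
      lintegral_singleton, ENNReal.div_mul_cancel (hν y) (measure_ne_top _ _)]
  have : IsSFiniteKernel (Kernel.withDensity (Kernel.const α ν) fun x y => κ x {y} / ν {y}) :=
    hκ ▸ inferInstance
  rw [← Measure.compProd_const, ← Measure.compProd_withDensity hmeas, ← hκ]

theorem integrable_comp_snd {β B : Type*} [MeasurableSpace β] [NormedAddCommGroup B]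
    {G : Measure α} [SFinite G]
    {κ : Kernel α β} [IsSFiniteKernel κ] {f : β → B} (hf : Integrable f (κ ∘ₘ G)) :
    Integrable (fun p : α × β => f p.2) (G ⊗ₘ κ) :=
  Integrable.comp_measurable (by rwa [← Measure.snd_compProd, Measure.snd] at hf) measurable_snd

/-- The Poisson channel with an arbitrary mean `r x` at the input `x`. -/
noncomputable def poissonRateKernel (r : α → ℝ≥0) (hr : Measurable r) : Kernel α ℕ :=
  ⟨fun x => poissonMeasure (r x), measurable_poissonMeasure.comp hr⟩

variable {r : α → ℝ≥0} (hr : Measurable r) {c C : ℝ} {F G : Measure α}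

@[simp]
theorem poissonRateKernel_apply (x : α) : poissonRateKernel r hr x = poissonMeasure (r x) := rfl

instance : IsMarkovKernel (poissonRateKernel r hr) :=
  ⟨fun x => inferInstanceAs (IsProbabilityMeasure (poissonMeasure (r x)))⟩

/-- The output law of the Poisson channel with mean `r` and input law `F`, freed of its
factorial denominators: `y !` times the probability of the output `y`. -/
noncomputable def outputMoment (r : α → ℝ≥0) (F : Measure α) (y : ℕ) : ℝ :=
  ∫ x, Real.exp (-r x) * r x ^ y ∂F

theorem comp_poissonRateKernel_real_singleton (y : ℕ) :
    (poissonRateKernel r hr ∘ₘ F).real {y} = outputMoment r F y / y ! := by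
  rw [outputMoment, ← integral_div, measureReal_def,
    Measure.bind_apply (.singleton y) (Kernel.aemeasurable _),
    integral_eq_lintegral_of_nonneg_ae (.of_forall fun x => by positivity) (by fun_prop)]
  simp only [poissonRateKernel_apply, poissonMeasure_singleton]

section Bounds

variable [IsProbabilityMeasure F]

include hr in
theorem outputMoment_mem (hc : 0 < c) (hF : ∀ᵐ x ∂F, (r x : ℝ) ∈ Icc c C) (y : ℕ) :
    outputMoment r F y ∈ Icc (Real.exp (-C) * c ^ y) (C ^ y) := by
  have hmem : ∀ᵐ x ∂F, Real.exp (-r x) * r x ^ y ∈ Icc (Real.exp (-C) * c ^ y) (C ^ y) := by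
    filter_upwards [hF] with x ⟨hcx, hxC⟩
    refine ⟨by gcongr, ?_⟩
    calc Real.exp (-r x) * r x ^ y ≤ 1 * (r x : ℝ) ^ y := by
          gcongr; exact Real.exp_le_one_iff.2 (by simp)
      _ ≤ C ^ y := by rw [one_mul]; gcongr
  exact (convex_Icc _ _).integral_mem isClosed_Icc hmem
    (.of_mem_Icc _ _ (by fun_prop) hmem)

include hr in
theorem outputMoment_pos (hc : 0 < c) (hF : ∀ᵐ x ∂F, (r x : ℝ) ∈ Icc c C) (y : ℕ) :
    0 < outputMoment r F y :=
  lt_of_lt_of_le (by positivity) (outputMoment_mem hr hc hF y).1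

theorem comp_poissonRateKernel_singleton_ne_zero (hc : 0 < c) (hF : ∀ᵐ x ∂F, (r x : ℝ) ∈ Icc c C)
    (y : ℕ) : (poissonRateKernel r hr ∘ₘ F) {y} ≠ 0 := by
  rw [← measureReal_ne_zero_iff, comp_poissonRateKernel_real_singleton]
  have := outputMoment_pos hr hc hF y
  positivity

include hr in
theorem abs_log_outputMoment_le (hc : 0 < c) (hF : ∀ᵐ x ∂F, (r x : ℝ) ∈ Icc c C) (y : ℕ) :
    |Real.log (outputMoment r F y)| ≤ (C + |Real.log c| + |Real.log C|) * 2 ^ y := by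
  obtain ⟨x, hcx, hxC⟩ := hF.exists
  have hC : 0 < C := hc.trans_le (hcx.trans hxC)
  have hone : (1 : ℝ) ≤ 2 ^ y := one_le_pow₀ one_le_two
  have hy : (y : ℝ) ≤ 2 ^ y := mod_cast Nat.lt_two_pow_self.le
  obtain ⟨hlower, hupper⟩ := outputMoment_mem hr hc hF y
  have hlog_lower := Real.log_le_log (by positivity) hlower
  have hlog_upper := Real.log_le_log (outputMoment_pos hr hc hF y) hupper
  rw [Real.log_mul (by positivity) (by positivity), Real.log_exp, Real.log_pow] at hlog_lower
  rw [Real.log_pow] at hlog_upper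
  calc |Real.log (outputMoment r F y)| ≤ C * 1 + |Real.log c| * y + |Real.log C| * y := by
        rw [abs_le]
        constructor <;>
          nlinarith [neg_abs_le (Real.log c), le_abs_self (Real.log C), abs_nonneg (Real.log c),
            abs_nonneg (Real.log C), Nat.cast_nonneg (α := ℝ) y]
    _ ≤ (C + |Real.log c| + |Real.log C|) * 2 ^ y := by
        rw [add_mul, add_mul]
        gcongr

theorem integrable_comp_poissonRateKernel_of_norm_le_pow (hF : ∀ᵐ x ∂F, (r x : ℝ) ≤ C)
    {B : Type*} [NormedAddCommGroup B] {f : ℕ → B} {K b : ℝ} (hf : ∀ y, ‖f y‖ ≤ K * b ^ y) :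
    Integrable f (poissonRateKernel r hr ∘ₘ F) := by
  have hK : 0 ≤ K := by simpa using (norm_nonneg _).trans (hf 0)
  rw [Measure.integrable_comp_iff .of_discrete]
  refine ⟨.of_forall fun x => integrable_poissonMeasure_of_norm_le_pow hf _,
    .of_bound (StronglyMeasurable.integral_kernel .of_discrete).aestronglyMeasurable
      (K * Real.exp (|b - 1| * C)) ?_⟩
  filter_upwards [hF] with x hx
  rw [Real.norm_of_nonneg (integral_nonneg fun _ => norm_nonneg _)]
  refine (integral_norm_poissonMeasure_le hf _).trans ?_
  gcongr
  exact le_abs_self _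

theorem integrable_log_outputMoment (hc : 0 < c) (hF : ∀ᵐ x ∂F, (r x : ℝ) ∈ Icc c C)
    [IsProbabilityMeasure G] (hG : ∀ᵐ x ∂G, (r x : ℝ) ∈ Icc c C) :
    Integrable (fun y => Real.log (outputMoment r F y)) (poissonRateKernel r hr ∘ₘ G) :=
  integrable_comp_poissonRateKernel_of_norm_le_pow hr (hG.mono fun _ hx => hx.2)
    (abs_log_outputMoment_le hr hc hF)

end Bounds

/-- The divergence of the output law of the Poisson channel at the input `x` from its output law
under the input law `F`; the mutual information is its mean under `F`. -/
noncomputable def infoDensity (r : α → ℝ≥0) (F : Measure α) (x : α) : ℝ :=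
  r x * Real.log (r x) - r x - ∫ y, Real.log (outputMoment r F y) ∂poissonMeasure (r x)

variable [IsProbabilityMeasure F] [IsProbabilityMeasure G]

theorem compProd_absolutelyContinuous_prod_comp (hc : 0 < c)
    (hF : ∀ᵐ x ∂F, (r x : ℝ) ∈ Icc c C) :
    G ⊗ₘ poissonRateKernel r hr ≪ G.prod (poissonRateKernel r hr ∘ₘ F) := by
  rw [compProd_eq_withDensity_prod G _ _ (comp_poissonRateKernel_singleton_ne_zero hr hc hF)]
  exact withDensity_absolutelyContinuous _ _

theorem llr_compProd_poissonRateKernel (hc : 0 < c) (hF : ∀ᵐ x ∂F, (r x : ℝ) ∈ Icc c C)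
    (hG : ∀ᵐ x ∂G, (r x : ℝ) ∈ Icc c C) :
    llr (G ⊗ₘ poissonRateKernel r hr) (G.prod (poissonRateKernel r hr ∘ₘ F))
      =ᵐ[G ⊗ₘ poissonRateKernel r hr]
    fun p => p.2 * Real.log (r p.1) - r p.1 - Real.log (outputMoment r F p.2) := by
  have hrn : (G ⊗ₘ poissonRateKernel r hr).rnDeriv (G.prod (poissonRateKernel r hr ∘ₘ F))
      =ᵐ[G ⊗ₘ poissonRateKernel r hr]
      fun p => poissonRateKernel r hr p.1 {p.2} / (poissonRateKernel r hr ∘ₘ F) {p.2} := by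
    refine (compProd_absolutelyContinuous_prod_comp hr hc hF).ae_le ?_
    rw [compProd_eq_withDensity_prod G (poissonRateKernel r hr) _
      (comp_poissonRateKernel_singleton_ne_zero hr hc hF)]
    exact Measure.rnDeriv_withDensity _ (measurable_kernel_singleton_div _ _)
  have hrate_mem : ∀ᵐ p ∂(G ⊗ₘ poissonRateKernel r hr), (r p.1 : ℝ) ∈ Icc c C :=
    Measure.ae_compProd_of_ae_fst _ (measurableSet_Icc.preimage (by fun_prop)) hG
  filter_upwards [hrn, hrate_mem] with p hp ⟨hcp, _⟩
  have hrate : 0 < (r p.1 : ℝ) := hc.trans_le hcp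
  have hfac : ((p.2 ! : ℕ) : ℝ) ≠ 0 := mod_cast Nat.factorial_ne_zero _
  rw [llr, hp, ENNReal.toReal_div, ← measureReal_def, ← measureReal_def,
    comp_poissonRateKernel_real_singleton, poissonRateKernel_apply, poissonMeasure_real_singleton,
    div_div_div_cancel_right₀ hfac,
    Real.log_div (by positivity) (outputMoment_pos hr hc hF p.2).ne',
    Real.log_mul (by positivity) (by positivity), Real.log_exp, Real.log_pow]
  ring

theorem integrable_llr_compProd_poissonRateKernel (hc : 0 < c) (hF : ∀ᵐ x ∂F, (r x : ℝ) ∈ Icc c C)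
    (hG : ∀ᵐ x ∂G, (r x : ℝ) ∈ Icc c C) :
    Integrable (fun p : α × ℕ => p.2 * Real.log (r p.1) - r p.1 - Real.log (outputMoment r F p.2))
      (G ⊗ₘ poissonRateKernel r hr) := by
  have hrate : ∀ᵐ p ∂(G ⊗ₘ poissonRateKernel r hr), (r p.1 : ℝ) ∈ Icc c C :=
    Measure.ae_compProd_of_ae_fst _ (measurableSet_Icc.preimage (by fun_prop)) hG
  have hcount : Integrable (fun y : ℕ => (y : ℝ)) (poissonRateKernel r hr ∘ₘ G) := by
    refine integrable_comp_poissonRateKernel_of_norm_le_pow hr (K := 1) (b := 2)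
      (hG.mono fun _ hx => hx.2) fun y => ?_
    simpa using mod_cast Nat.lt_two_pow_self.le
  have hlog : ∀ᵐ p ∂(G ⊗ₘ poissonRateKernel r hr),
      Real.log (r p.1) ∈ Icc (Real.log c) (Real.log C) := by
    filter_upwards [hrate] with p ⟨hcp, hpC⟩
    exact ⟨Real.log_le_log hc hcp, Real.log_le_log (hc.trans_le hcp) hpC⟩
  refine (Integrable.sub ?_ (.of_mem_Icc _ _ (by fun_prop) hrate)).sub
    (integrable_comp_snd (integrable_log_outputMoment hr hc hF hG))
  exact (integrable_comp_snd hcount).mul_bdd (c := max |Real.log c| |Real.log C|)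
    (Measurable.aestronglyMeasurable (by fun_prop))
    (hlog.mono fun p hp => abs_le_max_abs_abs hp.1 hp.2)

theorem crossInfo_poissonRateKernel_ne_top (hc : 0 < c) (hF : ∀ᵐ x ∂F, (r x : ℝ) ∈ Icc c C)
    (hG : ∀ᵐ x ∂G, (r x : ℝ) ∈ Icc c C) : crossInfo (poissonRateKernel r hr) F G ≠ ∞ :=
  klDiv_ne_top (compProd_absolutelyContinuous_prod_comp hr hc hF)
    ((integrable_llr_compProd_poissonRateKernel hr hc hF hG).congr
      (llr_compProd_poissonRateKernel hr hc hF hG).symm)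

omit [IsProbabilityMeasure F] in
theorem integral_llr_poissonMeasure (x : α)
    (hlog : Integrable (fun y => Real.log (outputMoment r F y)) (poissonMeasure (r x))) :
    ∫ y : ℕ, y * Real.log (r x) - r x - Real.log (outputMoment r F y) ∂poissonMeasure (r x) =
      infoDensity r F x := by
  have hcount : Integrable (fun y : ℕ => (y : ℝ) * Real.log (r x)) (poissonMeasure (r x)) :=
    (integrable_poissonMeasure_of_norm_le_pow (K := 1) (b := 2)
      (fun y => by simpa using mod_cast Nat.lt_two_pow_self.le) _).mul_const _
  have hlinear : Integrable (fun y : ℕ => (y : ℝ) * Real.log (r x) - r x) (poissonMeasure (r x)) :=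
    hcount.sub (integrable_const _)
  rw [integral_sub hlinear hlog,
    integral_sub hcount (integrable_const _), integral_mul_const, integral_id_poissonMeasure,
    integral_const, probReal_univ, one_smul, infoDensity]

theorem toReal_crossInfo_poissonRateKernel (hc : 0 < c) (hF : ∀ᵐ x ∂F, (r x : ℝ) ∈ Icc c C)
    (hG : ∀ᵐ x ∂G, (r x : ℝ) ∈ Icc c C) :
    (crossInfo (poissonRateKernel r hr) F G).toReal = ∫ x, infoDensity r F x ∂G := by
  rw [crossInfo, toReal_klDiv_of_measure_eq (compProd_absolutelyContinuous_prod_comp hr hc hF)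
    (by simp), integral_congr_ae (llr_compProd_poissonRateKernel hr hc hF hG),
    Measure.integral_compProd (integrable_llr_compProd_poissonRateKernel hr hc hF hG)]
  exact integral_congr_ae (.of_forall fun x => integral_llr_poissonMeasure x
    (integrable_poissonMeasure_of_norm_le_pow (abs_log_outputMoment_le hr hc hF) _))

include hr in
theorem integrable_infoDensity (hc : 0 < c)
    (hF : ∀ᵐ x ∂F, (r x : ℝ) ∈ Icc c C) (hG : ∀ᵐ x ∂G, (r x : ℝ) ∈ Icc c C) :
    Integrable (infoDensity r F) G :=
  ((integrable_llr_compProd_poissonRateKernel hr hc hF hG).integral_compProd).congr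
    (.of_forall fun x => integral_llr_poissonMeasure x
      (integrable_poissonMeasure_of_norm_le_pow (abs_log_outputMoment_le hr hc hF) _))

-- A Poisson law of mean `r` has the generating function `exp (i t r)` at `1 + i t`, so that of the
-- output law at this point is the characteristic function of the law of the mean.
theorem map_eq_of_comp_poissonRateKernel_eq (hF : ∀ᵐ x ∂F, (r x : ℝ) ≤ C)
    (hG : ∀ᵐ x ∂G, (r x : ℝ) ≤ C) (h : poissonRateKernel r hr ∘ₘ F = poissonRateKernel r hr ∘ₘ G) :
    F.map (fun x => (r x : ℝ)) = G.map fun x => (r x : ℝ) := by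
  have hchar : ∀ (H : Measure α) [IsProbabilityMeasure H], (∀ᵐ x ∂H, (r x : ℝ) ≤ C) → ∀ t : ℝ,
      charFun (H.map fun x => (r x : ℝ)) t =
        ∫ y, (1 + t * Complex.I : ℂ) ^ y ∂(poissonRateKernel r hr ∘ₘ H) := fun H _ hH t => by
    rw [integral_comp_kernel (integrable_comp_poissonRateKernel_of_norm_le_pow hr (K := 1) hH
      fun y => by rw [norm_pow, one_mul]), charFun_apply_real,
      integral_map (by fun_prop) (by fun_prop)]
    refine integral_congr_ae (.of_forall fun x => ?_)
    simp only [poissonRateKernel_apply, integral_cpow_poissonMeasure, add_sub_cancel_left,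
      mul_right_comm _ Complex.I]
  refine Measure.ext_of_charFun (funext fun t => ?_)
  rw [hchar F hF, hchar G hG, h]

end PoissonRateKernel

section Laws

open scoped Nat unitInterval

variable {α : Type*} [MeasurableSpace α]

/-- The probability measures carried by `K`. -/
def lawsOn (K : Set α) : Set (ProbabilityMeasure α) :=
  {F | ∀ᵐ x ∂(F : Measure α), x ∈ K}

theorem ae_of_mem_lawsOn {K : Set α} {F : ProbabilityMeasure α} (hF : F ∈ lawsOn K) {p : α → Prop}
    (hp : ∀ x ∈ K, p x) : ∀ᵐ x ∂(F : Measure α), p x :=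
  Eventually.mono hF hp

theorem nonempty_of_mem_lawsOn {K : Set α} {F : ProbabilityMeasure α} (hF : F ∈ lawsOn K) :
    K.Nonempty :=
  Eventually.exists (f := ae (F : Measure α)) hF

/-- The mixture of two laws with weights `1 - t` and `t`. -/
noncomputable def mixture (F G : ProbabilityMeasure α) (t : I) : ProbabilityMeasure α :=
  ⟨ENNReal.ofReal (1 - t) • (F : Measure α) + ENNReal.ofReal t • (G : Measure α), ⟨by
    simp [← ENNReal.ofReal_add (sub_nonneg.2 t.2.2) t.2.1]⟩⟩

theorem coe_mixture (F G : ProbabilityMeasure α) (t : I) : (mixture F G t : Measure α) =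
    ENNReal.ofReal (1 - t) • (F : Measure α) + ENNReal.ofReal t • (G : Measure α) := rfl

theorem integral_mixture {F G : ProbabilityMeasure α} {t : I} {u : α → ℝ}
    (hF : Integrable u (F : Measure α)) (hG : Integrable u (G : Measure α)) :
    ∫ x, u x ∂(mixture F G t : Measure α) =
      (1 - t) * ∫ x, u x ∂(F : Measure α) + t * ∫ x, u x ∂(G : Measure α) := by
  rw [coe_mixture, integral_add_measure (hF.smul_measure ENNReal.ofReal_ne_top)
    (hG.smul_measure ENNReal.ofReal_ne_top), integral_smul_measure, integral_smul_measure,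
    ENNReal.toReal_ofReal (sub_nonneg.2 t.2.2), ENNReal.toReal_ofReal t.2.1, smul_eq_mul,
    smul_eq_mul]

theorem mixture_mem_lawsOn {K : Set α} {F G : ProbabilityMeasure α} (hF : F ∈ lawsOn K)
    (hG : G ∈ lawsOn K) (t : I) : mixture F G t ∈ lawsOn K := by
  rw [lawsOn, mem_ofPred_eq, coe_mixture, ae_add_measure_iff]
  exact ⟨Measure.ae_smul_measure hF _, Measure.ae_smul_measure hG _⟩

theorem mixture_zero (F G : ProbabilityMeasure α) : mixture F G 0 = F :=
  ProbabilityMeasure.toMeasure_injective (by simp [coe_mixture])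

theorem continuous_mixture [TopologicalSpace α] [OpensMeasurableSpace α]
    (F G : ProbabilityMeasure α) : Continuous (mixture F G) := by
  rw [ProbabilityMeasure.continuous_iff_forall_continuous_integral]
  intro f
  simp only [integral_mixture (f.integrable _) (f.integrable _)]
  fun_prop

theorem integral_diracProba [MeasurableSingletonClass α] (u : α → ℝ) (x : α) :
    ∫ y, u y ∂(diracProba x : Measure α) = u x :=
  integral_dirac u x

theorem diracProba_mem_lawsOn [MeasurableSingletonClass α] {K : Set α} {x : α} (hx : x ∈ K) :
    diracProba x ∈ lawsOn K := by
  change ∀ᵐ y ∂Measure.dirac x, y ∈ K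
  rw [ae_dirac_eq]
  exact hx

variable [MetricSpace α] [BorelSpace α] {K : Set α}

theorem isCompact_lawsOn (hK : IsCompact K) : IsCompact (lawsOn K) := by
  convert! isCompact_setOfPred_probabilityMeasure_mass_eq_compl_isCompact_le
    (tendsto_const_nhds (x := (0 : ℝ≥0)) (f := atTop)) (fun _ : ℕ => hK) (.inl inferInstance)
    using 1
  ext F
  simp [lawsOn, ae_iff, compl_def]

theorem integrable_of_mem_lawsOn (hK : IsCompact K) {F : ProbabilityMeasure α} (hF : F ∈ lawsOn K)
    {u : α → ℝ} (hu : ContinuousOn u K) : Integrable u (F : Measure α) := by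
  rw [← Measure.restrict_eq_self_of_ae_mem hF]
  exact hu.integrableOn_compact hK

theorem continuousOn_integral_lawsOn (hK : IsCompact K) {u : α → ℝ} (hu : ContinuousOn u K) :
    ContinuousOn (fun F : ProbabilityMeasure α => ∫ x, u x ∂(F : Measure α)) (lawsOn K) := by
  have : CompactSpace K := isCompact_iff_compactSpace.1 hK
  obtain ⟨v, -, hv⟩ := BoundedContinuousFunction.exists_norm_eq_domRestrict_eq_of_closed
    (.mkOfCompact ⟨K.domRestrict u, hu.domRestrict⟩) hK.isClosed
  refine (ProbabilityMeasure.continuous_integral_boundedContinuousFunction v).continuousOn.congr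
    fun F hF => integral_congr_ae ?_
  filter_upwards [hF] with x hx
  exact congr($hv ⟨x, hx⟩).symm

variable {r : α → ℝ≥0} (hr : Continuous r) {c C : ℝ}

include hr

omit [MeasurableSpace α] [BorelSpace α] in
theorem continuous_mul_log_sub : Continuous fun x => (r x : ℝ) * Real.log (r x) - r x :=
  (Real.continuous_mul_log.comp (NNReal.continuous_coe.comp hr)).sub
    (NNReal.continuous_coe.comp hr)

theorem continuousOn_outputMoment (hK : IsCompact K) (y : ℕ) :
    ContinuousOn (fun F : ProbabilityMeasure α => outputMoment r (F : Measure α) y) (lawsOn K) :=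
  continuousOn_integral_lawsOn hK (by fun_prop)

theorem integral_infoDensity_eq_sub_tsum (hK : IsCompact K) (hc : 0 < c)
    (hrate : ∀ x ∈ K, (r x : ℝ) ∈ Icc c C) {F G : ProbabilityMeasure α} (hF : F ∈ lawsOn K)
    (hG : G ∈ lawsOn K) :
    ∫ x, infoDensity r (F : Measure α) x ∂(G : Measure α) =
      ∫ x, (r x : ℝ) * Real.log (r x) - r x ∂(G : Measure α) -
        ∑' y : ℕ, outputMoment r (G : Measure α) y / y ! *
          Real.log (outputMoment r (F : Measure α) y) := by
  have hlinear : Integrable (fun x => (r x : ℝ) * Real.log (r x) - r x) (G : Measure α) :=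
    integrable_of_mem_lawsOn hK hG (continuous_mul_log_sub hr).continuousOn
  have hlog := integrable_log_outputMoment hr.measurable hc (ae_of_mem_lawsOn hF hrate)
    (ae_of_mem_lawsOn hG hrate)
  have hmean : Integrable (fun x => ∫ y, Real.log (outputMoment r (F : Measure α) y)
      ∂poissonMeasure (r x)) (G : Measure α) := by
    simpa only [infoDensity, sub_sub_cancel, Pi.sub_def] using
      hlinear.sub (integrable_infoDensity hr.measurable hc (ae_of_mem_lawsOn hF hrate)
        (ae_of_mem_lawsOn hG hrate))
  simp only [infoDensity]
  rw [integral_sub hlinear hmean]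
  congr 1
  refine (integral_comp_kernel hlog).symm.trans ?_
  simp only [integral_countable hlog, comp_poissonRateKernel_real_singleton, smul_eq_mul]

theorem continuousOn_integral_infoDensity (hK : IsCompact K) (hc : 0 < c)
    (hrate : ∀ x ∈ K, (r x : ℝ) ∈ Icc c C) :
    ContinuousOn (fun p : ProbabilityMeasure α × ProbabilityMeasure α =>
      ∫ x, infoDensity r (p.1 : Measure α) x ∂(p.2 : Measure α)) (lawsOn K ×ˢ lawsOn K) := by
  refine ContinuousOn.congr ?_ fun p hp =>
    integral_infoDensity_eq_sub_tsum hr hK hc hrate hp.1 hp.2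
  refine ((continuousOn_integral_lawsOn hK (continuous_mul_log_sub hr).continuousOn).comp
    continuousOn_snd fun p hp => hp.2).sub ?_
  have hmoment := continuousOn_outputMoment hr hK
  refine continuousOn_tsum (fun y => ?_) ((Real.summable_pow_div_factorial (2 * C)).mul_left
    (C + |Real.log c| + |Real.log C|)) ?_
  · refine (((hmoment y).comp continuousOn_snd fun p hp => hp.2).div_const _).mul
      (((hmoment y).comp continuousOn_fst fun p hp => hp.1).log fun p hp => ?_)
    exact (outputMoment_pos hr.measurable hc (ae_of_mem_lawsOn hp.1 hrate) y).ne'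
  · rintro y ⟨F, G⟩ ⟨hF, hG⟩
    have hG_pos := outputMoment_pos hr.measurable hc (ae_of_mem_lawsOn hG hrate) y
    have hG_le := (outputMoment_mem hr.measurable hc (ae_of_mem_lawsOn hG hrate) y).2
    rw [norm_mul, Real.norm_of_nonneg (by positivity), Real.norm_eq_abs]
    calc _ ≤ C ^ y / y ! * ((C + |Real.log c| + |Real.log C|) * 2 ^ y) := by
          gcongr
          · exact div_nonneg (hG_pos.le.trans hG_le) (by positivity)
          · exact abs_log_outputMoment_le hr.measurable hc (ae_of_mem_lawsOn hF hrate) y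
      _ = (C + |Real.log c| + |Real.log C|) * ((2 * C) ^ y / y !) := by rw [mul_pow]; ring

end Laws

section PoissonChannel

/-- The mean of the output of the Poisson channel with input intensity `x`. -/
noncomputable def poissonRate (g d s x : ℝ) : ℝ≥0 := ((g * x + d) * s).toNNReal

/-- Positivity of the gain `g`, the dark current `d` and the slot length `s` of a Poisson
channel. -/
structure PoissonParams (g d s : ℝ) : Prop where
  gain_pos : 0 < g
  dark_pos : 0 < d
  slot_pos : 0 < s

variable {g d s A : ℝ}

@[fun_prop]
theorem continuous_poissonRate : Continuous (poissonRate g d s) := by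
  unfold poissonRate
  fun_prop

theorem poissonChannel_eq_poissonRateKernel (g d s : ℝ) : poissonChannel g d s =
    poissonRateKernel (poissonRate g d s) continuous_poissonRate.measurable := rfl

instance : IsMarkovKernel (poissonChannel g d s) := by
  rw [poissonChannel_eq_poissonRateKernel]
  infer_instance

namespace PoissonParams

theorem dark_mul_slot_pos (hp : PoissonParams g d s) : 0 < d * s := mul_pos hp.dark_pos hp.slot_pos

theorem coe_poissonRate (hp : PoissonParams g d s) {x : ℝ} (hx : 0 ≤ x) :
    (poissonRate g d s x : ℝ) = (g * x + d) * s :=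
  Real.coe_toNNReal _ <| mul_nonneg (add_nonneg (mul_nonneg hp.gain_pos.le hx) hp.dark_pos.le)
    hp.slot_pos.le

theorem poissonRate_mem (hp : PoissonParams g d s) {x : ℝ} (hx : x ∈ Icc 0 A) :
    (poissonRate g d s x : ℝ) ∈ Icc (d * s) ((g * A + d) * s) := by
  have hg := hp.gain_pos.le
  have hs := hp.slot_pos.le
  rw [hp.coe_poissonRate hx.1]
  constructor
  · gcongr
    exact le_add_of_nonneg_left (mul_nonneg hg hx.1)
  · gcongr
    exact hx.2

variable {F G : ProbabilityMeasure ℝ}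

theorem crossInfo_ne_top (hp : PoissonParams g d s) (hF : F ∈ lawsOn (Icc 0 A))
    (hG : G ∈ lawsOn (Icc 0 A)) : crossInfo (poissonChannel g d s) (F : Measure ℝ) G ≠ ∞ :=
  crossInfo_poissonRateKernel_ne_top continuous_poissonRate.measurable
    hp.dark_mul_slot_pos
    (ae_of_mem_lawsOn hF fun _ => hp.poissonRate_mem)
    (ae_of_mem_lawsOn hG fun _ => hp.poissonRate_mem)

theorem toReal_crossInfo (hp : PoissonParams g d s) (hF : F ∈ lawsOn (Icc 0 A))
    (hG : G ∈ lawsOn (Icc 0 A)) : (crossInfo (poissonChannel g d s) (F : Measure ℝ) G).toReal =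
      ∫ x, infoDensity (poissonRate g d s) F x ∂(G : Measure ℝ) :=
  toReal_crossInfo_poissonRateKernel continuous_poissonRate.measurable hp.dark_mul_slot_pos
    (ae_of_mem_lawsOn hF fun _ => hp.poissonRate_mem)
    (ae_of_mem_lawsOn hG fun _ => hp.poissonRate_mem)

theorem integrable_infoDensity (hp : PoissonParams g d s) (hF : F ∈ lawsOn (Icc 0 A))
    (hG : G ∈ lawsOn (Icc 0 A)) :
    Integrable (infoDensity (poissonRate g d s) F) (G : Measure ℝ) :=
  _root_.integrable_infoDensity continuous_poissonRate.measurable hp.dark_mul_slot_pos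
    (ae_of_mem_lawsOn hF fun _ => hp.poissonRate_mem)
    (ae_of_mem_lawsOn hG fun _ => hp.poissonRate_mem)

theorem eq_of_comp_poissonChannel_eq (hp : PoissonParams g d s) (hF : F ∈ lawsOn (Icc 0 A))
    (hG : G ∈ lawsOn (Icc 0 A))
    (h : poissonChannel g d s ∘ₘ (F : Measure ℝ) = poissonChannel g d s ∘ₘ G) : F = G := by
  have hinput : ∀ {H : ProbabilityMeasure ℝ}, H ∈ lawsOn (Icc 0 A) →
      ((H : Measure ℝ).map fun x => (poissonRate g d s x : ℝ)).map (fun r => (r / s - d) / g) =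
        H := by
    intro H hH
    rw [Measure.map_map (by fun_prop) (by fun_prop)]
    refine (Measure.map_congr (ae_of_mem_lawsOn hH fun x hx => ?_)).trans Measure.map_id
    simp only [Function.comp_apply, hp.coe_poissonRate hx.1, id]
    rw [mul_div_cancel_right₀ _ hp.slot_pos.ne', add_sub_cancel_right,
      mul_div_cancel_left₀ _ hp.gain_pos.ne']
  refine ProbabilityMeasure.toMeasure_injective ?_
  rw [← hinput hF, ← hinput hG, map_eq_of_comp_poissonRateKernel_eq
    continuous_poissonRate.measurable (ae_of_mem_lawsOn hF fun _ hx => (hp.poissonRate_mem hx).2)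
    (ae_of_mem_lawsOn hG fun _ hx => (hp.poissonRate_mem hx).2) h]

end PoissonParams

end PoissonChannel

namespace PoissonWiretap.IsDegraded

open unitInterval

variable {W : PoissonWiretap} (hW : W.IsDegraded) {A : ℝ} {F G : ProbabilityMeasure ℝ}

include hW

theorem paramsE : PoissonParams W.gainE W.darkE W.slot :=
  ⟨hW.gainE_pos, hW.darkE_pos, hW.slot_pos⟩

theorem paramsB : PoissonParams W.gainB W.darkB W.slot :=
  ⟨hW.gainE_pos.trans_le hW.gain_le, hW.darkB_pos, hW.slot_pos⟩

theorem gainE_div_gainB_mul_darkB_le : W.gainE / W.gainB * W.darkB ≤ W.darkE := by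
  have hle := hW.dark_le
  rw [div_le_div_iff₀ hW.paramsB.gain_pos hW.gainE_pos] at hle
  rw [div_mul_eq_mul_div, div_le_iff₀ hW.paramsB.gain_pos]
  linarith

/-- The probability with which a count of the legitimate receiver also reaches the eavesdropper,
when the eavesdropper's channel is realized as a degradation of the legitimate receiver's. -/
noncomputable def thinning : I :=
  ⟨W.gainE / W.gainB, div_nonneg hW.gainE_pos.le hW.paramsB.gain_pos.le,
    (div_le_one hW.paramsB.gain_pos).2 hW.gain_le⟩

/-- The mean of the counts of the eavesdropper that do not come from the legitimate receiver. -/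
noncomputable def excess : ℝ≥0 :=
  NNReal.mk ((W.darkE - W.gainE / W.gainB * W.darkB) * W.slot)
    (mul_nonneg (sub_nonneg.2 hW.gainE_div_gainB_mul_darkB_le) hW.slot_pos.le)

theorem thinning_pos : 0 < (hW.thinning : ℝ) := div_pos hW.gainE_pos hW.paramsB.gain_pos

theorem thinning_lt_one_or_excess_pos : (hW.thinning : ℝ) < 1 ∨ 0 < hW.excess := by
  have hg := hW.paramsB.gain_pos
  refine hW.strict.imp (div_lt_one hg).2 fun h => mul_pos (sub_pos.2 ?_) hW.slot_pos
  rw [div_lt_div_iff₀ hg hW.gainE_pos] at h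
  rw [div_mul_eq_mul_div, div_lt_iff₀ hg]
  linarith

theorem poissonRate_eq {x : ℝ} (hx : 0 ≤ x) : poissonRate W.gainE W.darkE W.slot x =
    Real.toNNReal hW.thinning * poissonRate W.gainB W.darkB W.slot x + hW.excess := by
  have hg := hW.paramsB.gain_pos
  refine NNReal.coe_injective ?_
  rw [NNReal.coe_add, NNReal.coe_mul, hW.paramsE.coe_poissonRate hx,
    hW.paramsB.coe_poissonRate hx, Real.coe_toNNReal _ hW.thinning.2.1, excess, NNReal.coe_mk,
    thinning]
  field_simp
  ring

theorem channelE_ae_eq (hF : F ∈ lawsOn (Icc 0 A)) : W.channelE =ᵐ[(F : Measure ℝ)]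
    thinningKernel hW.thinning hW.excess ∘ₖ W.channelB := by
  refine ae_of_mem_lawsOn hF fun x hx => ?_
  rw [Kernel.comp_apply, channelB, channelE, poissonChannel_eq_poissonRateKernel,
    poissonChannel_eq_poissonRateKernel, poissonRateKernel_apply, poissonRateKernel_apply,
    thinningKernel_comp_poissonMeasure, hW.poissonRate_eq hx.1]

theorem comp_channelE (hF : F ∈ lawsOn (Icc 0 A)) : W.channelE ∘ₘ (F : Measure ℝ) =
    thinningKernel hW.thinning hW.excess ∘ₘ (W.channelB ∘ₘ (F : Measure ℝ)) := by
  rw [Measure.comp_assoc, Measure.comp_congr (hW.channelE_ae_eq hF)]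

end PoissonWiretap.IsDegraded

section FeasibleInputs

open scoped unitInterval

variable {A E : ℝ} {F G : ProbabilityMeasure ℝ}

theorem mem_feasibleInputs_iff :
    F ∈ feasibleInputs A E ↔ F ∈ lawsOn (Icc 0 A) ∧ ∫ x, x ∂(F : Measure ℝ) ≤ E := by
  have hcarrier : (F : Measure ℝ) (Icc 0 A) = 1 ↔ F ∈ lawsOn (Icc 0 A) := by
    rw [← prob_compl_eq_zero_iff measurableSet_Icc]
    rfl
  rw [feasibleInputs, mem_ofPred_eq, hcarrier]
  refine and_congr_right fun hF => ?_
  rw [Measure.restrict_eq_self_of_ae_mem hF]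

theorem feasibleInputs_subset_lawsOn : feasibleInputs A E ⊆ lawsOn (Icc 0 A) :=
  fun _ hF => (mem_feasibleInputs_iff.1 hF).1

theorem isCompact_feasibleInputs : IsCompact (feasibleInputs A E) := by
  have hinter : feasibleInputs A E = lawsOn (Icc 0 A) ∩
      (fun F : ProbabilityMeasure ℝ => ∫ x, x ∂(F : Measure ℝ)) ⁻¹' Iic E :=
    Set.ext fun F => mem_feasibleInputs_iff
  have hlaws := isCompact_lawsOn (isCompact_Icc (a := (0 : ℝ)) (b := A))
  rw [hinter]
  exact hlaws.of_isClosed_subset ((continuousOn_integral_lawsOn isCompact_Icc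
    continuousOn_id).preimage_isClosed_of_isClosed hlaws.isClosed isClosed_Iic) inter_subset_left

theorem integrable_id_of_mem_lawsOn (hF : F ∈ lawsOn (Icc 0 A)) :
    Integrable (fun x => x) (F : Measure ℝ) :=
  integrable_of_mem_lawsOn isCompact_Icc hF continuousOn_id

theorem mixture_mem_feasibleInputs (hF : F ∈ feasibleInputs A E) (hG : G ∈ feasibleInputs A E)
    (t : I) : mixture F G t ∈ feasibleInputs A E := by
  rw [mem_feasibleInputs_iff] at *
  refine ⟨mixture_mem_lawsOn hF.1 hG.1 t, ?_⟩
  rw [integral_mixture (integrable_id_of_mem_lawsOn hF.1) (integrable_id_of_mem_lawsOn hG.1)]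
  exact convex_Iic E hF.2 hG.2 (sub_nonneg.2 t.2.2) t.2.1 (sub_add_cancel 1 (t : ℝ))

theorem diracProba_zero_mem_feasibleInputs (hA : 0 ≤ A) (hE : 0 ≤ E) :
    diracProba 0 ∈ feasibleInputs A E :=
  mem_feasibleInputs_iff.2 ⟨diracProba_mem_lawsOn (left_mem_Icc.2 hA),
    (integral_diracProba _ 0).trans_le hE⟩

end FeasibleInputs

section CrossGain

open scoped unitInterval

theorem toReal_crossInfo_eq_add {α β : Type*} [MeasurableSpace α] [StandardBorelSpace α]
    [Nonempty α] [MeasurableSpace β] {κ : Kernel α β} [IsMarkovKernel κ] {F G : Measure α}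
    [IsProbabilityMeasure F] [IsProbabilityMeasure G] (htop : crossInfo κ F G ≠ ∞) :
    (crossInfo κ F G).toReal =
      (klDiv (κ ∘ₘ G) (κ ∘ₘ F)).toReal + (crossInfo κ G G).toReal := by
  rw [crossInfo_eq_klDiv_add_mutualInfo] at htop ⊢
  rw [ENNReal.add_ne_top] at htop
  exact ENNReal.toReal_add htop.1 htop.2

namespace PoissonWiretap

/-- The density of `I(X;Y) - ν I(X;Z)` at the intensity `x` when the input has law `F`: the
derivative of this difference in the direction of the point mass at `x`, up to a constant. -/
noncomputable def gainDensity (W : PoissonWiretap) (ν : ℝ) (F : ProbabilityMeasure ℝ) (x : ℝ) : ℝ :=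
  infoDensity (poissonRate W.gainB W.darkB W.slot) F x -
    ν * infoDensity (poissonRate W.gainE W.darkE W.slot) F x

/-- The difference `I(X;Y) - ν I(X;Z)` with the densities of the input law `F` averaged over the
input law `G`; its value at `F = G` is the difference itself. -/
noncomputable def crossGain (W : PoissonWiretap) (ν : ℝ) (F G : ProbabilityMeasure ℝ) : ℝ :=
  ∫ x, W.gainDensity ν F x ∂(G : Measure ℝ)

variable {W : PoissonWiretap} {A ν : ℝ} {F G H : ProbabilityMeasure ℝ}

instance : IsMarkovKernel W.channelB := inferInstanceAs (IsMarkovKernel (poissonChannel _ _ _))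

instance : IsMarkovKernel W.channelE := inferInstanceAs (IsMarkovKernel (poissonChannel _ _ _))

namespace IsDegraded

variable (hW : W.IsDegraded)

include hW

theorem mutualInfo_channelB_ne_top (hF : F ∈ lawsOn (Icc 0 A)) :
    mutualInfo (F : Measure ℝ) W.channelB ≠ ∞ :=
  hW.paramsB.crossInfo_ne_top hF hF

theorem mutualInfo_channelE_ne_top (hF : F ∈ lawsOn (Icc 0 A)) :
    mutualInfo (F : Measure ℝ) W.channelE ≠ ∞ :=
  hW.paramsE.crossInfo_ne_top hF hF

theorem integrable_gainDensity (ν : ℝ) (hF : F ∈ lawsOn (Icc 0 A)) (hG : G ∈ lawsOn (Icc 0 A)) :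
    Integrable (W.gainDensity ν F) (G : Measure ℝ) :=
  (hW.paramsB.integrable_infoDensity hF hG).sub
    ((hW.paramsE.integrable_infoDensity hF hG).const_mul ν)

theorem crossGain_eq_integral_sub (ν : ℝ) (hF : F ∈ lawsOn (Icc 0 A)) (hG : G ∈ lawsOn (Icc 0 A)) :
    W.crossGain ν F G =
      ∫ x, infoDensity (poissonRate W.gainB W.darkB W.slot) F x ∂(G : Measure ℝ) -
        ν * ∫ x, infoDensity (poissonRate W.gainE W.darkE W.slot) F x ∂(G : Measure ℝ) := by
  rw [← integral_const_mul]
  exact integral_sub (hW.paramsB.integrable_infoDensity hF hG)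
    ((hW.paramsE.integrable_infoDensity hF hG).const_mul ν)

theorem crossGain_eq_crossInfo_sub (ν : ℝ) (hF : F ∈ lawsOn (Icc 0 A))
    (hG : G ∈ lawsOn (Icc 0 A)) : W.crossGain ν F G =
      (crossInfo W.channelB (F : Measure ℝ) G).toReal -
        ν * (crossInfo W.channelE (F : Measure ℝ) G).toReal := by
  rw [hW.crossGain_eq_integral_sub ν hF hG, channelB, channelE, hW.paramsB.toReal_crossInfo hF hG,
    hW.paramsE.toReal_crossInfo hF hG]

theorem objective_eq (μ : ℝ) (hF : F ∈ lawsOn (Icc 0 A)) :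
    W.objective μ F = 1 / W.slot * W.crossGain (1 - μ) F F := by
  rw [hW.crossGain_eq_crossInfo_sub _ hF hF, objective, infoB, infoE, mutualInfo, mutualInfo,
    crossInfo, crossInfo]
  ring

theorem toReal_klDiv_comp_channelE_lt (hF : F ∈ lawsOn (Icc 0 A)) (hG : G ∈ lawsOn (Icc 0 A))
    (hne : F ≠ G) :
    (klDiv (W.channelE ∘ₘ (F : Measure ℝ)) (W.channelE ∘ₘ (G : Measure ℝ))).toReal <
      (klDiv (W.channelB ∘ₘ (F : Measure ℝ)) (W.channelB ∘ₘ (G : Measure ℝ))).toReal := by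
  have htop : klDiv (W.channelB ∘ₘ (F : Measure ℝ)) (W.channelB ∘ₘ (G : Measure ℝ)) ≠ ∞ := by
    have hcross := hW.paramsB.crossInfo_ne_top hG hF
    rw [crossInfo_eq_klDiv_add_mutualInfo, ENNReal.add_ne_top] at hcross
    exact hcross.1
  rw [hW.comp_channelE hF, hW.comp_channelE hG]
  refine ENNReal.toReal_strict_mono htop (lt_of_le_of_ne (klDiv_comp_right_le _ _ _) fun heq => ?_)
  exact hne (hW.paramsB.eq_of_comp_poissonChannel_eq hF hG (eq_of_klDiv_comp_eq
    (thinningKernel_overlap hW.thinning_pos hW.thinning_lt_one_or_excess_pos) htop heq))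

theorem crossGain_self_lt (hν : ν ≤ 1) (hF : F ∈ lawsOn (Icc 0 A)) (hG : G ∈ lawsOn (Icc 0 A))
    (hne : F ≠ G) : W.crossGain ν G G < W.crossGain ν F G := by
  have hB : (crossInfo W.channelB (F : Measure ℝ) G).toReal = _ :=
    toReal_crossInfo_eq_add (hW.paramsB.crossInfo_ne_top hF hG)
  have hE : (crossInfo W.channelE (F : Measure ℝ) G).toReal = _ :=
    toReal_crossInfo_eq_add (hW.paramsE.crossInfo_ne_top hF hG)
  have hlt := hW.toReal_klDiv_comp_channelE_lt hG hF hne.symm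
  have hscaled := mul_le_of_le_one_left (ENNReal.toReal_nonneg (a := klDiv
    (W.channelE ∘ₘ (G : Measure ℝ)) (W.channelE ∘ₘ (F : Measure ℝ)))) hν
  rw [hW.crossGain_eq_crossInfo_sub ν hF hG, hW.crossGain_eq_crossInfo_sub ν hG hG, hB, hE]
  linarith

theorem crossGain_self_le (hν : ν ≤ 1) (hF : F ∈ lawsOn (Icc 0 A)) (hG : G ∈ lawsOn (Icc 0 A)) :
    W.crossGain ν G G ≤ W.crossGain ν F G := by
  obtain rfl | hne := eq_or_ne F G
  · rfl
  · exact (hW.crossGain_self_lt hν hF hG hne).le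

theorem crossGain_mixture (hF : F ∈ lawsOn (Icc 0 A)) (hG : G ∈ lawsOn (Icc 0 A))
    (hH : H ∈ lawsOn (Icc 0 A)) (t : I) : W.crossGain ν H (mixture F G t) =
      (1 - t) * W.crossGain ν H F + t * W.crossGain ν H G :=
  integral_mixture (hW.integrable_gainDensity ν hH hF) (hW.integrable_gainDensity ν hH hG)

theorem continuousOn_crossGain (ν : ℝ) :
    ContinuousOn (fun p : ProbabilityMeasure ℝ × ProbabilityMeasure ℝ => W.crossGain ν p.1 p.2)
      (lawsOn (Icc 0 A) ×ˢ lawsOn (Icc 0 A)) := by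
  refine ContinuousOn.congr ?_ fun p hp => hW.crossGain_eq_integral_sub ν hp.1 hp.2
  exact (continuousOn_integral_infoDensity continuous_poissonRate isCompact_Icc
    hW.paramsB.dark_mul_slot_pos fun x => hW.paramsB.poissonRate_mem).sub
    ((continuousOn_integral_infoDensity continuous_poissonRate isCompact_Icc
      hW.paramsE.dark_mul_slot_pos fun x => hW.paramsE.poissonRate_mem).const_mul ν)

end IsDegraded

end PoissonWiretap

end CrossGain

namespace PoissonWiretap.IsDegraded

open scoped unitInterval

variable {W : PoissonWiretap} (hW : W.IsDegraded) {A E μ : ℝ} {F G : ProbabilityMeasure ℝ}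

include hW

theorem continuousOn_objective (μ : ℝ) : ContinuousOn (W.objective μ) (lawsOn (Icc 0 A)) := by
  refine ContinuousOn.congr ?_ fun F hF => hW.objective_eq μ hF
  exact continuousOn_const.mul ((hW.continuousOn_crossGain (1 - μ)).comp
    (f := fun F => (F, F)) (by fun_prop) fun F hF => ⟨hF, hF⟩)

theorem objective_concave (hμ : 0 ≤ μ) (hF : F ∈ lawsOn (Icc 0 A)) (hG : G ∈ lawsOn (Icc 0 A))
    (t : I) : (1 - t) * W.objective μ F + t * W.objective μ G ≤
      W.objective μ (mixture F G t) := by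
  have hM := mixture_mem_lawsOn hF hG t
  have hν : 1 - μ ≤ 1 := sub_le_self 1 hμ
  rw [hW.objective_eq μ hF, hW.objective_eq μ hG, hW.objective_eq μ hM,
    hW.crossGain_mixture hF hG hM, mul_left_comm, mul_left_comm (t : ℝ), ← mul_add]
  have hslot := hW.slot_pos.le
  have ht := sub_nonneg.2 t.2.2
  have ht' := t.2.1
  gcongr
  · exact hW.crossGain_self_le hν hM hF
  · exact hW.crossGain_self_le hν hM hG

theorem isMaxOn_objective_iff (hF : F ∈ feasibleInputs A E) :
    IsMaxOn (W.objective μ) (feasibleInputs A E) F ↔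
      ∀ G ∈ feasibleInputs A E, W.crossGain (1 - μ) G G ≤ W.crossGain (1 - μ) F F := by
  refine forall₂_congr fun G hG => ?_
  rw [mem_ofPred_eq, hW.objective_eq μ (feasibleInputs_subset_lawsOn hG),
    hW.objective_eq μ (feasibleInputs_subset_lawsOn hF)]
  exact mul_le_mul_iff_right₀ (one_div_pos.2 hW.slot_pos)

theorem exists_isMaxOn_objective (hA : 0 ≤ A) (hE : 0 ≤ E) (μ : ℝ) :
    ∃ F ∈ feasibleInputs A E, IsMaxOn (W.objective μ) (feasibleInputs A E) F :=
  isCompact_feasibleInputs.exists_isMaxOn ⟨_, diracProba_zero_mem_feasibleInputs hA hE⟩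
    ((hW.continuousOn_objective μ).mono feasibleInputs_subset_lawsOn)

theorem crossGain_le_of_isMaxOn_objective (hμ : 0 ≤ μ) (hF : F ∈ feasibleInputs A E)
    (hmax : IsMaxOn (W.objective μ) (feasibleInputs A E) F) (hG : G ∈ feasibleInputs A E) :
    W.crossGain (1 - μ) F G ≤ W.crossGain (1 - μ) F F := by
  rw [hW.isMaxOn_objective_iff hF] at hmax
  have hF' := feasibleInputs_subset_lawsOn hF
  have hG' := feasibleInputs_subset_lawsOn hG
  have hcont : Continuous fun t => W.crossGain (1 - μ) (mixture F G t) G := by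
    rw [← continuousOn_univ]
    exact (hW.continuousOn_crossGain (1 - μ)).comp
      ((continuous_mixture F G).prodMk continuous_const).continuousOn
      fun t _ => ⟨mixture_mem_lawsOn hF' hG' t, hG'⟩
  have hle : ∀ t : I, 0 < t → W.crossGain (1 - μ) (mixture F G t) G ≤
      W.crossGain (1 - μ) F F := by
    intro t ht
    have hM := mixture_mem_lawsOn hF' hG' t
    have hgap := mul_le_mul_of_nonneg_left (hW.crossGain_self_le (sub_le_self 1 hμ) hM hF')
      (sub_nonneg.2 t.2.2)
    have hopt := hmax _ (mixture_mem_feasibleInputs hF hG t)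
    rw [hW.crossGain_mixture hF' hG' hM] at hopt
    refine le_of_mul_le_mul_left ?_ (show (0 : ℝ) < t from ht)
    linarith
  have := nhdsGT_neBot_of_exists_gt ⟨(1 : I), zero_lt_one⟩
  have hlim := (hcont.tendsto 0).mono_left (nhdsWithin_le_nhds (s := Ioi 0))
  rw [mixture_zero] at hlim
  exact le_of_tendsto hlim (eventually_nhdsWithin_of_forall hle)

theorem eq_of_isMaxOn_objective (hμ : 0 ≤ μ) (hF : F ∈ feasibleInputs A E)
    (hG : G ∈ feasibleInputs A E) (hFmax : IsMaxOn (W.objective μ) (feasibleInputs A E) F)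
    (hGmax : IsMaxOn (W.objective μ) (feasibleInputs A E) G) : G = F := by
  by_contra! hne
  refine (hW.crossGain_self_lt (sub_le_self 1 hμ) (feasibleInputs_subset_lawsOn hF)
    (feasibleInputs_subset_lawsOn hG) hne.symm).not_ge ?_
  exact (hW.crossGain_le_of_isMaxOn_objective hμ hF hFmax hG).trans
    ((hW.isMaxOn_objective_iff hG).1 hGmax F hF)

end PoissonWiretap.IsDegraded

section SupportingLine

theorem apply_nonpos_of_forall_apply_add_smul_le {V : Type*} [AddCommGroup V] [Module ℝ V]
    {f : V →ₗ[ℝ] ℝ} {p v : V} {u : ℝ} (hle : ∀ t : ℝ, 0 ≤ t → f (p + t • v) ≤ u) : f v ≤ 0 := by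
  by_contra! hpos
  have hp : f p ≤ u := by simpa using hle 0 le_rfl
  have hfar := hle ((u - f p + 1) / f v) (div_nonneg (by linarith) hpos.le)
  rw [map_add, map_smul, smul_eq_mul, div_mul_cancel₀ _ hpos.ne'] at hfar
  linarith

theorem exists_separating_of_not_dominated {R : Set (ℝ × ℝ)} (hR : Convex ℝ R) {p : ℝ × ℝ}
    (hp : p ∈ R) (hdom : ∀ q ∈ R, ¬(p.1 < q.1 ∧ p.2 < q.2)) :
    ∃ f : ℝ × ℝ →L[ℝ] ℝ, (∀ v, 0 ≤ v → f v ≤ 0) ∧ f (1, 1) < 0 ∧ ∀ q ∈ R, f p ≤ f q := by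
  obtain ⟨f, u, hlt, hge⟩ := geometric_hahn_banach_open ((convex_Ioi p.1).prod (convex_Ioi p.2))
    (isOpen_Ioi.prod isOpen_Ioi) hR (Set.disjoint_left.2 fun q hq hqR => hdom q hqR hq)
  have hle : ∀ v, 0 ≤ v → f (p + v) ≤ u := by
    intro v hv
    refine closure_minimal (t := f ⁻¹' Iic u) (fun q hq => (hlt q hq).le)
      (isClosed_Iic.preimage f.continuous) ?_
    rw [closure_prod_eq, closure_Ioi, closure_Ioi]
    exact ⟨le_add_of_nonneg_right hv.1, le_add_of_nonneg_right hv.2⟩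
  have hpu : f p = u := le_antisymm (by simpa using hle 0 le_rfl) (hge p hp)
  refine ⟨f, fun v hv => apply_nonpos_of_forall_apply_add_smul_le (f := f.toLinearMap)
    fun t ht => hle (t • v) (smul_nonneg ht hv), ?_, fun q hq => hpu.trans_le (hge q hq)⟩
  have hdiag := hlt (p + (1, 1)) (by simp)
  rwa [map_add, hpu, add_lt_iff_neg_left] at hdiag

theorem exists_weight_of_not_dominated {R : Set (ℝ × ℝ)} (hR : Convex ℝ R) {p : ℝ × ℝ} (hp : p ∈ R)
    (hdom : ∀ q ∈ R, ¬(p.1 < q.1 ∧ p.2 < q.2)) :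
    ∃ μ ∈ Icc (0 : ℝ) 1, ∀ q ∈ R, μ * q.1 + (1 - μ) * q.2 ≤ μ * p.1 + (1 - μ) * p.2 := by
  obtain ⟨f, hcone, hdiag, hmin⟩ := exists_separating_of_not_dominated hR hp hdom
  have hfst : f (1, 0) ≤ 0 := hcone _ (by simp [Prod.le_def])
  have hsnd : f (0, 1) ≤ 0 := hcone _ (by simp [Prod.le_def])
  have hf (q : ℝ × ℝ) : f q = q.1 * f (1, 0) + q.2 * f (0, 1) := by
    rw [← smul_eq_mul, ← smul_eq_mul, ← map_smul, ← map_smul, ← map_add]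
    simp
  have hsum : f (1, 0) + f (0, 1) < 0 := by simpa [hf (1, 1)] using hdiag
  have hcompl : 1 - f (1, 0) / (f (1, 0) + f (0, 1)) = f (0, 1) / (f (1, 0) + f (0, 1)) := by
    rw [one_sub_div hsum.ne, add_sub_cancel_left]
  have hnormalized (q : ℝ × ℝ) : f (1, 0) / (f (1, 0) + f (0, 1)) * q.1 +
      (1 - f (1, 0) / (f (1, 0) + f (0, 1))) * q.2 = f q / (f (1, 0) + f (0, 1)) := by
    rw [hcompl, hf q]
    ring
  refine ⟨f (1, 0) / (f (1, 0) + f (0, 1)), ⟨div_nonneg_of_nonpos hfst hsum.le,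
    (div_le_one_of_neg hsum).2 (add_le_of_nonpos_right hsnd)⟩, fun q hq => ?_⟩
  rw [hnormalized, hnormalized]
  exact div_le_div_of_nonpos_of_le hsum.le (hmin q hq)

end SupportingLine

section Lagrange

variable {α : Type*} [MeasurableSpace α] {K : Set α} {u g : α → ℝ} {b : ℝ}
  {F : ProbabilityMeasure α}

theorem convex_setOf_integral_le
    (hu : ∀ G ∈ lawsOn K, Integrable u (G : Measure α))
    (hg : ∀ G ∈ lawsOn K, Integrable g (G : Measure α)) :
    Convex ℝ {q : ℝ × ℝ | ∃ G ∈ lawsOn K,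
      q.1 ≤ -∫ x, u x ∂(G : Measure α) ∧ q.2 ≤ ∫ x, g x ∂(G : Measure α)} := by
  rintro p ⟨G, hG, hp⟩ q ⟨H, hH, hq⟩ s t hs ht hst
  obtain rfl : s = 1 - t := eq_sub_of_add_eq hst
  refine ⟨mixture G H ⟨t, ht, sub_nonneg.1 hs⟩, mixture_mem_lawsOn hG hH _, ?_⟩
  rw [integral_mixture (hu G hG) (hu H hH), integral_mixture (hg G hG) (hg H hH)]
  have hp_fst := mul_le_mul_of_nonneg_left hp.1 hs
  have hq_fst := mul_le_mul_of_nonneg_left hq.1 ht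
  constructor
  · calc _ ≤ (1 - t) * -∫ x, u x ∂(G : Measure α) + t * -∫ x, u x ∂(H : Measure α) :=
          add_le_add hp_fst hq_fst
      _ = _ := by ring
  · exact add_le_add (mul_le_mul_of_nonneg_left hp.2 hs) (mul_le_mul_of_nonneg_left hq.2 ht)

theorem exists_multiplier
    (hu : ∀ G ∈ lawsOn K, Integrable u (G : Measure α))
    (hg : ∀ G ∈ lawsOn K, Integrable g (G : Measure α))
    (hF : F ∈ lawsOn K) (hFb : ∫ x, u x ∂(F : Measure α) ≤ b)
    (hmax : ∀ G ∈ lawsOn K, ∫ x, u x ∂(G : Measure α) ≤ b →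
      ∫ x, g x ∂(G : Measure α) ≤ ∫ x, g x ∂(F : Measure α))
    (hslater : ∃ G ∈ lawsOn K, ∫ x, u x ∂(G : Measure α) < b) :
    ∃ γ, 0 ≤ γ ∧ ∀ G ∈ lawsOn K, ∫ x, g x ∂(G : Measure α) ≤
      ∫ x, g x ∂(F : Measure α) + γ * (∫ x, u x ∂(G : Measure α) - b) := by
  obtain ⟨μ, hμ, hsupport⟩ := exists_weight_of_not_dominated (convex_setOf_integral_le hu hg)
    (p := (-b, ∫ x, g x ∂(F : Measure α))) ⟨F, hF, neg_le_neg hFb, le_rfl⟩ <| by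
      rintro q ⟨G, hG, hcost, hgain⟩ ⟨hlt_cost, hlt_gain⟩
      exact (hmax G hG (neg_le_neg_iff.1 (hlt_cost.le.trans hcost))).not_gt
        (hlt_gain.trans_le hgain)
  have hbound : ∀ G ∈ lawsOn K, (1 - μ) * ∫ x, g x ∂(G : Measure α) ≤
      (1 - μ) * ∫ x, g x ∂(F : Measure α) + μ * (∫ x, u x ∂(G : Measure α) - b) := by
    intro G hG
    have hG_support := hsupport (-∫ x, u x ∂(G : Measure α), ∫ x, g x ∂(G : Measure α))
      ⟨G, hG, le_rfl, le_rfl⟩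
    linarith
  have hpos : 0 < 1 - μ := by
    refine (sub_nonneg.2 hμ.2).lt_of_ne' fun hzero => ?_
    obtain ⟨G, hG, hlt⟩ := hslater
    have hG_bound := hbound G hG
    rw [(sub_eq_zero.1 hzero).symm] at hG_bound
    linarith
  refine ⟨μ / (1 - μ), div_nonneg hμ.1 hpos.le, fun G hG => ?_⟩
  rw [← mul_le_mul_iff_right₀ hpos, mul_add, ← mul_assoc, mul_div_cancel₀ _ hpos.ne']
  exact hbound G hG

theorem exists_ae_eq_affine_of_isMaxOn [MeasurableSingletonClass α]
    (hu : ∀ G ∈ lawsOn K, Integrable u (G : Measure α))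
    (hg : ∀ G ∈ lawsOn K, Integrable g (G : Measure α))
    (hF : F ∈ lawsOn K) (hFb : ∫ x, u x ∂(F : Measure α) ≤ b)
    (hmax : ∀ G ∈ lawsOn K, ∫ x, u x ∂(G : Measure α) ≤ b →
      ∫ x, g x ∂(G : Measure α) ≤ ∫ x, g x ∂(F : Measure α))
    (hslater : ∃ G ∈ lawsOn K, ∫ x, u x ∂(G : Measure α) < b) :
    ∃ γ C : ℝ, ∀ᵐ x ∂(F : Measure α), g x = γ * u x + C := by
  obtain ⟨γ, hγ, hbound⟩ := exists_multiplier hu hg hF hFb hmax hslater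
  set C := ∫ x, g x ∂(F : Measure α) - γ * b with hC
  have hlinear : Integrable (fun x => γ * u x) (F : Measure α) := (hu F hF).const_mul γ
  have hle : ∀ᵐ x ∂(F : Measure α), g x ≤ γ * u x + C := by
    refine ae_of_mem_lawsOn hF fun x hx => ?_
    have hpoint := hbound _ (diracProba_mem_lawsOn hx)
    rw [integral_diracProba, integral_diracProba] at hpoint
    linarith [hC]
  have haffine := hlinear.add (integrable_const C)
  refine ⟨γ, C, (integral_eq_iff_of_ae_le (hg F hF) haffine hle).1 ?_⟩
  refine le_antisymm (integral_mono_ae (hg F hF) haffine hle) ?_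
  have hcost := mul_le_mul_of_nonneg_left hFb hγ
  simp only [Pi.add_apply]
  rw [integral_add hlinear (integrable_const C), integral_const_mul]
  simp only [integral_const, probReal_univ, one_smul]
  linarith [hC]

end Lagrange

section Analytic

open scoped Nat

/-- The mean of `c` under the Poisson law of mean `t`, continued to all real `t` by its power
series. -/
noncomputable def poissonMean (c : ℕ → ℝ) (t : ℝ) : ℝ :=
  Real.exp (-t) * ∑' y : ℕ, c y / y ! * t ^ y

/-- The information density of a Poisson channel as a function of the output mean `t`, when `c y`
is the logarithm of the output moment of order `y`. -/
noncomputable def poissonDensity (c : ℕ → ℝ) (t : ℝ) : ℝ :=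
  t * Real.log t - t - poissonMean c t

theorem integral_eq_poissonMean (c : ℕ → ℝ) (r : ℝ≥0) :
    ∫ y, c y ∂poissonMeasure r = poissonMean c r := by
  rw [integral_poissonMeasure, poissonMean, ← tsum_mul_left]
  refine tsum_congr fun y => ?_
  rw [smul_eq_mul]
  ring

theorem infoDensity_eq_poissonDensity {α : Type*} [MeasurableSpace α] (r : α → ℝ≥0)
    (F : Measure α) (x : α) :
    infoDensity r F x = poissonDensity (fun y => Real.log (outputMoment r F y)) (r x) := by
  rw [infoDensity, poissonDensity, integral_eq_poissonMean]

variable {c cB cE : ℕ → ℝ} {M MB ME q qB qE t : ℝ}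

theorem analyticAt_poissonMean (hc : ∀ y, |c y| ≤ M * q ^ y) (t : ℝ) :
    AnalyticAt ℝ (poissonMean c) t := by
  set p := FormalMultilinearSeries.ofScalars ℝ fun y : ℕ => c y / (y ! : ℝ)
  have hradius : p.radius = ⊤ := by
    refine FormalMultilinearSeries.radius_eq_top_of_summable_norm _ fun r => ?_
    refine Summable.of_nonneg_of_le (fun n => by positivity) (fun n => ?_)
      ((Real.summable_pow_div_factorial (q * r)).mul_left M)
    rw [FormalMultilinearSeries.ofScalars_norm, norm_div, Real.norm_eq_abs, Real.norm_natCast]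
    calc |c n| / n ! * (r : ℝ) ^ n ≤ (M * q ^ n) / n ! * (r : ℝ) ^ n := by gcongr; exact hc n
      _ = M * ((q * r) ^ n / n !) := by rw [mul_pow]; ring
  have hseries : AnalyticAt ℝ p.sum t := by
    refine (p.hasFPowerSeriesOnBall ?_).analyticAt_of_mem ?_ <;> simp [hradius]
  have hsum : p.sum = fun t => ∑' y : ℕ, c y / y ! * t ^ y :=
    FormalMultilinearSeries.ofScalarsSum_eq_tsum _
  rw [hsum] at hseries
  exact (show AnalyticAt ℝ (fun t => Real.exp (-t)) t by fun_prop).mul hseries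

theorem analyticAt_poissonDensity (hc : ∀ y, |c y| ≤ M * q ^ y) (ht : 0 < t) :
    AnalyticAt ℝ (poissonDensity c) t :=
  ((analyticAt_id.mul (analyticAt_log ht)).sub analyticAt_id).sub (analyticAt_poissonMean hc t)

theorem eqOn_zero_of_infinite_zeros {f : ℝ → ℝ} {U K : Set ℝ} (hf : AnalyticOnNhd ℝ f U)
    (hU : IsPreconnected U) (hK : IsCompact K) (hKU : K ⊆ U) (hzeros : {t ∈ K | f t = 0}.Infinite) :
    EqOn f 0 U := by
  obtain ⟨t₀, ht₀, hacc⟩ := hzeros.exists_accPt_of_subset_isCompact hK (sep_subset _ _)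
  exact hf.eqOn_zero_of_preconnected_of_frequently_eq_zero hU (hKU ht₀)
    ((accPt_iff_frequently_nhdsNE.1 hacc).mono fun t ht => ht.2)

theorem not_differentiableAt_of_eq_mul_log {κ : ℝ} (hκ : 0 < κ) {f : ℝ → ℝ}
    (hf : ∀ t, 0 < t → f t = κ * (t * Real.log t)) : ¬DifferentiableAt ℝ f 0 := by
  intro hdiff
  have hderiv : ∀ᶠ t in 𝓝[>] (0 : ℝ), κ * (Real.log t + 1) = deriv f t := by
    filter_upwards [self_mem_nhdsWithin] with t ht
    have heq : f =ᶠ[𝓝 t] fun t => κ * (t * Real.log t) :=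
      eventually_of_mem (Ioi_mem_nhds ht) hf
    rw [heq.deriv_eq, ((Real.hasDerivAt_mul_log (ne_of_gt ht)).const_mul κ).deriv]
  exact not_differentiableWithinAt_of_deriv_tendsto_atBot_Ioi f
    (((Real.tendsto_log_nhdsGT_zero.atBot_add tendsto_const_nhds).const_mul_atBot hκ).congr' hderiv)
    hdiff.differentiableWithinAt

-- At `t = 0` every term is differentiable except `t log t`, which occurs with the positive
-- coefficient `1 - ν θ` if `e = 0` and with the coefficient `1` otherwise.
theorem not_forall_poissonDensity_sub_eq_affine (hcB : ∀ y, |cB y| ≤ MB * qB ^ y)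
    (hcE : ∀ y, |cE y| ≤ ME * qE ^ y) {θ e ν γ C : ℝ} (hθ : 0 < θ) (he : 0 ≤ e)
    (hlossy : θ < 1 ∨ 0 < e) (hν : ν ≤ 1) :
    ¬∀ t, 0 < t → poissonDensity cB t - ν * poissonDensity cE (θ * t + e) = γ * t + C := by
  intro haffine
  have hB := (analyticAt_poissonMean hcB 0).differentiableAt
  obtain rfl | he := he.eq_or_lt
  · have hκ : 0 < 1 - ν * θ :=
      sub_pos.2 ((mul_le_of_le_one_left hθ.le hν).trans_lt (hlossy.resolve_right (lt_irrefl 0)))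
    have hE : DifferentiableAt ℝ (fun t => poissonMean cE (θ * t)) 0 :=
      (analyticAt_poissonMean hcE (θ * 0)).differentiableAt.comp 0 (by fun_prop)
    refine not_differentiableAt_of_eq_mul_log hκ (f := fun t => t + poissonMean cB t +
      ν * (θ * t * Real.log θ - θ * t - poissonMean cE (θ * t)) + (γ * t + C)) (fun t ht => ?_)
      (by fun_prop)
    rw [← haffine t ht, add_zero, poissonDensity, poissonDensity, Real.log_mul hθ.ne' ht.ne']
    ring
  · have hE : DifferentiableAt ℝ (fun t => poissonDensity cE (θ * t + e)) 0 :=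
      (analyticAt_poissonDensity hcE (by simpa using he)).differentiableAt.comp 0 (by fun_prop)
    refine not_differentiableAt_of_eq_mul_log one_pos (f := fun t => t + poissonMean cB t +
      ν * poissonDensity cE (θ * t + e) + (γ * t + C)) (fun t ht => ?_) (by fun_prop)
    rw [← haffine t ht, poissonDensity, poissonDensity]
    ring

theorem finite_setOf_poissonDensity_sub_eq_affine (hcB : ∀ y, |cB y| ≤ MB * qB ^ y)
    (hcE : ∀ y, |cE y| ≤ ME * qE ^ y) {θ e ν : ℝ} (hθ : 0 < θ) (he : 0 ≤ e)
    (hlossy : θ < 1 ∨ 0 < e) (hν : ν ≤ 1) {a : ℝ} (ha : 0 < a) (b γ C : ℝ) :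
    {t ∈ Icc a b |
      poissonDensity cB t - ν * poissonDensity cE (θ * t + e) = γ * t + C}.Finite := by
  refine not_infinite.1 fun hinfinite => ?_
  have hanalytic : AnalyticOnNhd ℝ (fun t => poissonDensity cB t -
      ν * poissonDensity cE (θ * t + e) - (γ * t + C)) (Ioi 0) := by
    intro t ht
    have hpos : 0 < θ * t + e := add_pos_of_pos_of_nonneg (mul_pos hθ ht) he
    have hB := analyticAt_poissonDensity hcB ht
    have hE := (analyticAt_poissonDensity hcE hpos).comp (f := fun t => θ * t + e) (by fun_prop)
    exact (hB.sub (analyticAt_const.mul hE)).sub (by fun_prop)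
  have hzero := eqOn_zero_of_infinite_zeros hanalytic isPreconnected_Ioi
    (isCompact_Icc (a := a) (b := b)) (fun t ht => ha.trans_le ht.1)
    (by simpa only [sub_eq_zero] using hinfinite)
  exact not_forall_poissonDensity_sub_eq_affine hcB hcE hθ he hlossy hν fun t ht =>
    sub_eq_zero.1 (hzero ht)

end Analytic

namespace PoissonWiretap.IsDegraded

variable {W : PoissonWiretap} (hW : W.IsDegraded) {A E ν μ : ℝ} {F : ProbabilityMeasure ℝ}

include hW

theorem finite_setOf_gainDensity_eq_affine (hν : ν ≤ 1) (hF : F ∈ lawsOn (Icc 0 A)) (γ C : ℝ) :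
    {x ∈ Icc 0 A | W.gainDensity ν F x = γ * x + C}.Finite := by
  have hg := hW.paramsB.gain_pos.ne'
  have hs := hW.slot_pos.ne'
  have hlogB := abs_log_outputMoment_le continuous_poissonRate.measurable
    hW.paramsB.dark_mul_slot_pos (ae_of_mem_lawsOn hF fun _ => hW.paramsB.poissonRate_mem)
  have hlogE := abs_log_outputMoment_le continuous_poissonRate.measurable
    hW.paramsE.dark_mul_slot_pos (ae_of_mem_lawsOn hF fun _ => hW.paramsE.poissonRate_mem)
  have hfinite := finite_setOf_poissonDensity_sub_eq_affine hlogB hlogE hW.thinning_pos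
    hW.excess.2 hW.thinning_lt_one_or_excess_pos hν hW.paramsB.dark_mul_slot_pos
    ((W.gainB * A + W.darkB) * W.slot) (γ / (W.gainB * W.slot)) (C - γ * W.darkB / W.gainB)
  refine (hfinite.preimage (f := fun x => (W.gainB * x + W.darkB) * W.slot) ?_).subset ?_
  · intro x _ y _ hxy
    exact mul_left_cancel₀ hg (add_right_cancel (mul_right_cancel₀ hs hxy))
  · rintro x ⟨hx, heq⟩
    have hrate := hW.paramsB.coe_poissonRate hx.1
    refine ⟨by simpa only [hrate] using hW.paramsB.poissonRate_mem hx, ?_⟩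
    rw [gainDensity, infoDensity_eq_poissonDensity, infoDensity_eq_poissonDensity,
      hW.poissonRate_eq hx.1, NNReal.coe_add, NNReal.coe_mul,
      Real.coe_toNNReal _ hW.thinning.2.1, hrate] at heq
    refine heq.trans ?_
    field_simp
    ring

theorem isFinitelyDiscrete_of_isMaxOn_objective (hE : 0 < E) (hμ : 0 ≤ μ)
    (hF : F ∈ feasibleInputs A E) (hmax : IsMaxOn (W.objective μ) (feasibleInputs A E) F) :
    IsFinitelyDiscrete F := by
  have hF' := feasibleInputs_subset_lawsOn hF
  have hA : 0 ≤ A := nonempty_Icc.1 (nonempty_of_mem_lawsOn hF')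
  have hslater : ∃ G ∈ lawsOn (Icc 0 A), ∫ x, x ∂(G : Measure ℝ) < E :=
    ⟨diracProba 0, diracProba_mem_lawsOn (left_mem_Icc.2 hA), (integral_diracProba _ 0).trans_lt hE⟩
  obtain ⟨γ, C, haffine⟩ := exists_ae_eq_affine_of_isMaxOn
    (fun G => integrable_id_of_mem_lawsOn) (fun G => hW.integrable_gainDensity (1 - μ) hF') hF'
    (mem_feasibleInputs_iff.1 hF).2 (fun G hG hGE => hW.crossGain_le_of_isMaxOn_objective hμ hF hmax
      (mem_feasibleInputs_iff.2 ⟨hG, hGE⟩)) hslater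
  have hfinite := hW.finite_setOf_gainDensity_eq_affine (sub_le_self 1 hμ) hF' γ C
  refine ⟨hfinite.toFinset, ?_⟩
  rw [hfinite.coe_toFinset, ← mem_ae_iff]
  filter_upwards [hF', haffine] with x hx hx_affine using ⟨hx, hx_affine⟩

end PoissonWiretap.IsDegraded

section Region

open scoped Pointwise unitInterval

theorem mem_frontier_of_not_dominated {R : Set (ℝ × ℝ)} {p : ℝ × ℝ} (hp : p ∈ R)
    (hdom : ∀ q ∈ R, ¬(p.1 < q.1 ∧ p.2 < q.2)) : p ∈ frontier R := by
  refine ⟨subset_closure hp, fun hinterior => ?_⟩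
  have hdiag : Tendsto (fun t : ℝ => (p.1 + t, p.2 + t)) (𝓝[>] 0) (𝓝 p) := by
    have hcont : Continuous fun t : ℝ => (p.1 + t, p.2 + t) := by fun_prop
    simpa only [add_zero] using (hcont.tendsto 0).mono_left nhdsWithin_le_nhds
  obtain ⟨t, ht, ht_pos⟩ :=
    ((hdiag.eventually (mem_interior_iff_mem_nhds.1 hinterior)).and self_mem_nhdsWithin).exists
  exact hdom _ ht ⟨lt_add_of_pos_right _ ht_pos, lt_add_of_pos_right _ ht_pos⟩

namespace PoissonWiretap

/-- The pair of largest rate and largest equivocation achieved by the input law `F`. -/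
noncomputable def ratePair (W : PoissonWiretap) (F : ProbabilityMeasure ℝ) : ℝ × ℝ :=
  (W.infoB F, W.infoB F - W.infoE F)

variable {W : PoissonWiretap} {A E μ : ℝ} {F G : ProbabilityMeasure ℝ} {p : ℝ × ℝ}

theorem objective_one (W : PoissonWiretap) : W.objective 1 = fun F => (W.ratePair F).1 := by
  funext F
  simp [objective, ratePair]

theorem objective_zero (W : PoissonWiretap) : W.objective 0 = fun F => (W.ratePair F).2 := by
  funext F
  simp [objective, ratePair]

theorem achieves_iff : W.Achieves F p ↔ 0 ≤ p ∧ p ≤ W.ratePair F :=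
  and_and_and_comm

theorem Achieves.le_objective (hp : W.Achieves F p) (hμ : μ ∈ Icc (0 : ℝ) 1) :
    μ * p.1 + (1 - μ) * p.2 ≤ W.objective μ F :=
  add_le_add (mul_le_mul_of_nonneg_left hp.1.2 hμ.1)
    (mul_le_mul_of_nonneg_left hp.2.2 (sub_nonneg.2 hμ.2))

theorem region_eq : W.region A E = Ici 0 ∩ (W.ratePair '' feasibleInputs A E + Iic 0) := by
  ext p
  simp only [region, achieves_iff, mem_ofPred_eq, mem_inter_iff, mem_Ici, Set.mem_add, mem_image,
    mem_Iic]
  constructor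
  · rintro ⟨F, hF, hp, hle⟩
    exact ⟨hp, _, ⟨F, hF, rfl⟩, p - W.ratePair F, sub_nonpos.2 hle, add_sub_cancel _ _⟩
  · rintro ⟨hp, _, ⟨F, hF, rfl⟩, v, hv, rfl⟩
    exact ⟨F, hF, hp, add_le_of_nonpos_right hv⟩

namespace IsDegraded

variable (hW : W.IsDegraded)

include hW

theorem ratePair_nonneg (hF : F ∈ lawsOn (Icc 0 A)) : 0 ≤ W.ratePair F := by
  have hslot : 0 ≤ 1 / W.slot := one_div_nonneg.2 hW.slot_pos.le
  have hle : mutualInfo (F : Measure ℝ) W.channelE ≤ mutualInfo (F : Measure ℝ) W.channelB :=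
    calc mutualInfo (F : Measure ℝ) W.channelE
        = mutualInfo (F : Measure ℝ) (thinningKernel hW.thinning hW.excess ∘ₖ W.channelB) := by
          rw [mutualInfo, mutualInfo, Measure.compProd_congr (hW.channelE_ae_eq hF),
            Measure.comp_congr (hW.channelE_ae_eq hF)]
      _ ≤ mutualInfo (F : Measure ℝ) W.channelB := mutualInfo_comp_le _ _ _
  exact ⟨mul_nonneg hslot ENNReal.toReal_nonneg, sub_nonneg.2 <| mul_le_mul_of_nonneg_left
    (ENNReal.toReal_mono (hW.mutualInfo_channelB_ne_top hF) hle) hslot⟩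

theorem ratePair_mem_region (hF : F ∈ feasibleInputs A E) : W.ratePair F ∈ W.region A E :=
  ⟨F, hF, achieves_iff.2 ⟨hW.ratePair_nonneg (feasibleInputs_subset_lawsOn hF), le_rfl⟩⟩

theorem isClosed_region : IsClosed (W.region A E) := by
  have hcont : ContinuousOn W.ratePair (feasibleInputs A E) := by
    have hrate := hW.continuousOn_objective (A := A) 1
    have hsecrecy := hW.continuousOn_objective (A := A) 0
    rw [objective_one] at hrate
    rw [objective_zero] at hsecrecy
    exact (hrate.prodMk hsecrecy).mono feasibleInputs_subset_lawsOn
  rw [region_eq]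
  exact isClosed_Ici.inter
    (isClosed_Iic.add_left_of_isCompact (isCompact_feasibleInputs.image_of_continuousOn hcont))

theorem ratePair_concave (hF : F ∈ lawsOn (Icc 0 A)) (hG : G ∈ lawsOn (Icc 0 A)) (t : I) :
    (1 - (t : ℝ)) • W.ratePair F + (t : ℝ) • W.ratePair G ≤ W.ratePair (mixture F G t) := by
  have hrate := hW.objective_concave zero_le_one hF hG t
  have hsecrecy := hW.objective_concave le_rfl hF hG t
  rw [objective_one] at hrate
  rw [objective_zero] at hsecrecy
  exact ⟨hrate, hsecrecy⟩

theorem convex_region : Convex ℝ (W.region A E) := by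
  rintro p ⟨F, hF, hp⟩ q ⟨G, hG, hq⟩ s t hs ht hst
  obtain rfl : s = 1 - t := eq_sub_of_add_eq hst
  rw [achieves_iff] at hp hq
  refine ⟨mixture F G ⟨t, ht, sub_nonneg.1 hs⟩, mixture_mem_feasibleInputs hF hG _,
    achieves_iff.2 ⟨add_nonneg (smul_nonneg hs hp.1) (smul_nonneg ht hq.1), ?_⟩⟩
  calc (1 - t) • p + t • q ≤ (1 - t) • W.ratePair F + t • W.ratePair G :=
        add_le_add (smul_le_smul_of_nonneg_left hp.2 hs) (smul_le_smul_of_nonneg_left hq.2 ht)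
    _ ≤ _ := hW.ratePair_concave (feasibleInputs_subset_lawsOn hF)
        (feasibleInputs_subset_lawsOn hG) ⟨t, ht, sub_nonneg.1 hs⟩

theorem ratePair_mem_boundary (hμ : μ ∈ Icc (0 : ℝ) 1) (hF : F ∈ feasibleInputs A E)
    (hmax : IsMaxOn (W.objective μ) (feasibleInputs A E) F) : W.ratePair F ∈ W.boundary A E := by
  have hmem := hW.ratePair_mem_region hF
  have hdom : ∀ q ∈ W.region A E, ¬((W.ratePair F).1 < q.1 ∧ (W.ratePair F).2 < q.2) := by
    rintro q ⟨G, hG, hq⟩ ⟨hrate, hsecrecy⟩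
    have hgain : 0 < μ * (q.1 - (W.ratePair F).1) + (1 - μ) * (q.2 - (W.ratePair F).2) :=
      convex_Ioi (0 : ℝ) (sub_pos.2 hrate) (sub_pos.2 hsecrecy) hμ.1 (sub_nonneg.2 hμ.2)
        (add_sub_cancel μ 1)
    have hle : μ * q.1 + (1 - μ) * q.2 ≤ μ * (W.ratePair F).1 + (1 - μ) * (W.ratePair F).2 :=
      (hq.le_objective hμ).trans (hmax hG)
    linarith
  exact ⟨mem_frontier_of_not_dominated hmem hdom, hdom⟩

theorem exists_isMaxOn_objective_of_mem_boundary (hp : p ∈ W.boundary A E) :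
    ∃ μ ∈ Icc (0 : ℝ) 1, ∀ F ∈ feasibleInputs A E, W.Achieves F p →
      IsMaxOn (W.objective μ) (feasibleInputs A E) F := by
  obtain ⟨μ, hμ, hsupport⟩ := exists_weight_of_not_dominated hW.convex_region
    (hW.isClosed_region.frontier_subset hp.1) hp.2
  exact ⟨μ, hμ, fun F _ hFp G hG =>
    (hsupport _ (hW.ratePair_mem_region hG)).trans (hFp.le_objective hμ)⟩

end IsDegraded

end PoissonWiretap

end Region

theorem theorem3_general (W : PoissonWiretap) (hW : W.IsDegraded) (A E : ℝ) (hA : 0 ≤ A)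
    (hE : 0 < E) :
    (∀ F ∈ feasibleInputs A E,
      mutualInfo (F : Measure ℝ) W.channelB ≠ ⊤ ∧ mutualInfo (F : Measure ℝ) W.channelE ≠ ⊤) ∧
    (∀ μ : ℝ, 0 ≤ μ → ∃ F ∈ feasibleInputs A E,
      IsMaxOn (W.objective μ) (feasibleInputs A E) F ∧
      (∀ G ∈ feasibleInputs A E, IsMaxOn (W.objective μ) (feasibleInputs A E) G → G = F) ∧
      IsFinitelyDiscrete F ∧
      (μ ≤ 1 → (W.infoB F, W.infoB F - W.infoE F) ∈ W.boundary A E)) ∧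
    (∀ p ∈ W.boundary A E, ∃ F ∈ feasibleInputs A E,
      W.Achieves F p ∧
      (∀ G ∈ feasibleInputs A E, W.Achieves G p → G = F) ∧
      IsFinitelyDiscrete F ∧
      ∃ μ ∈ Icc (0 : ℝ) 1, IsMaxOn (W.objective μ) (feasibleInputs A E) F) := by
  refine ⟨fun F hF => ?_, fun μ hμ => ?_, fun p hp => ?_⟩
  · exact ⟨hW.mutualInfo_channelB_ne_top (feasibleInputs_subset_lawsOn hF),
      hW.mutualInfo_channelE_ne_top (feasibleInputs_subset_lawsOn hF)⟩
  · obtain ⟨F, hF, hmax⟩ := hW.exists_isMaxOn_objective hA hE.le μ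
    exact ⟨F, hF, hmax, fun G hG hGmax => hW.eq_of_isMaxOn_objective hμ hF hG hmax hGmax,
      hW.isFinitelyDiscrete_of_isMaxOn_objective hE hμ hF hmax,
      fun hμ_le => hW.ratePair_mem_boundary ⟨hμ, hμ_le⟩ hF hmax⟩
  · obtain ⟨F, hF, hFp⟩ := hW.isClosed_region.frontier_subset hp.1
    obtain ⟨μ, hμ, hmax⟩ := hW.exists_isMaxOn_objective_of_mem_boundary hp
    exact ⟨F, hF, hFp, fun G hG hGp =>
        hW.eq_of_isMaxOn_objective hμ.1 hF hG (hmax F hF hFp) (hmax G hG hGp),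
      hW.isFinitelyDiscrete_of_isMaxOn_objective hE hμ.1 hF (hmax F hF hFp), μ, hμ, hmax F hF hFp⟩

theorem theorem3 (W : PoissonWiretap) (hW : W.IsDegraded) (A E : ℝ) (hA : 0 < A) (hE : 0 < E) :
    -- all mutual informations involved are finite
    (∀ F ∈ feasibleInputs A E,
      mutualInfo (F : Measure ℝ) W.channelB ≠ ⊤ ∧ mutualInfo (F : Measure ℝ) W.channelE ≠ ⊤) ∧
    -- each weighted objective has a unique maximizer; it is discrete with finitely many mass
    -- points, and its rate-equivocation pair lies on the boundary
    (∀ μ ∈ Icc (0 : ℝ) 1, ∃ F ∈ feasibleInputs A E,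
      IsMaxOn (W.objective μ) (feasibleInputs A E) F ∧
      (∀ G ∈ feasibleInputs A E, IsMaxOn (W.objective μ) (feasibleInputs A E) G → G = F) ∧
      IsFinitelyDiscrete F ∧
      (W.infoB F, W.infoB F - W.infoE F) ∈ W.boundary A E) ∧
    -- each boundary point is achieved by a unique input law; that law is discrete with finitely
    -- many mass points and maximizes one of the weighted objectives
    (∀ p ∈ W.boundary A E, ∃ F ∈ feasibleInputs A E,
      W.Achieves F p ∧
      (∀ G ∈ feasibleInputs A E, W.Achieves G p → G = F) ∧
      IsFinitelyDiscrete F ∧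
      ∃ μ ∈ Icc (0 : ℝ) 1, IsMaxOn (W.objective μ) (feasibleInputs A E) F) := by
  obtain ⟨hfinite, hmaximizer, hboundary⟩ := theorem3_general W hW A E hA.le hE
  exact ⟨hfinite, fun μ hμ => by simpa only [hμ.2, forall_const] using hmaximizer μ hμ.1, hboundary⟩
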